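/- Let $J_{2n}=\begin{pmatrix}0&I_n\\-I_n&0\end{pmatrix}$. A real $2n\times 2n$ matrix $M$ is Hamiltonian if $M^T=J_{2n}MJ_{2n}$, and two such matrices are symplectically similar if they are conjugate by a symplectic matrix. $M$ is indecomposable if $n\ge 1$ and $\mathbb R^{2n}$ is not the direct sum of two proper, $M$-invariant, $J_{2n}$-orthogonal symplectic subspaces. *Normal forms.* Let $\beta_0>0$. Every Hamiltonian $2N\times 2N$ matrix $M$ is symplectically similar to a matrix $$\begin{pmatrix}\mathrm{diag}(D_1,\dots,D_s)&\mathrm{diag}(B_1,\dots,B_s)\\ \mathrm{diag}(C_1,\dots,C_s)&\mathrm{diag}(-D_1^T,\dots,-D_s^T)\end{pmatrix},\qquad M_j=\begin{pmatrix}D_j&B_j\\C_j&-D_j^T\end{pmatrix},$$ with indecomposable Hamiltonian $2N_j\times 2N_j$ blocks $M_j$, $N_1+\dots+N_s=N$, in which every block with eigenvalue $\beta_0 i$ is, for some $\epsilon=\pm1$, one of the following (its spectrum is then $\{\pm\beta_0 i\}$, and it is said to correspond to $\pm\beta_0 i$). * $N_j$ odd: $D_j$ has entries $1$ directly below the diagonal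 and $0$ elsewhere, $B_j=-\epsilon\beta_0R$ and $C_j=\epsilon\beta_0R$, where $R_{a,N_j+1-a}=(-1)^{a+1}$ and all other entries of $R$ vanish. * $N_j$ even: $D_j$ has $2\times2$ blocks $\begin{pmatrix}0&-\beta_0\\\beta_0&0\end{pmatrix}$ on the diagonal, $I_2$ directly below them and $0$ elsewhere, $B_j=0$, and $C_j$ has $\epsilon I_2$ in its lower right corner and $0$ elsewhere. Let $o_\pm(\beta_0,M)$ (respectively $e_\pm(\beta_0,M)$) be the number of blocks of the first kind with $\epsilon=\pm1$ for which $\frac{N_j+1}{2}$ is odd (respectively even). The pair $\pm\beta_0 i$ of eigenvalues of $M$ is called simple if exactly one block corresponds to it and this block is of dimension two; equivalently, $\beta_0 i$ has algebraic multiplicity one. *Proposition.* Let $\Omega\subset\mathbb R^{2N}$ be open with $0\in\Omega$, and let $H\in C^2(\Omega,\mathbb R)$ satisfy $H'(0)=0$. Assume (A0): the eigenvalues of $J_{2N}H''(0)$, listed with algebraic multiplicities, are $\lambda_1=\beta_0i$, $\lambda_2=-\beta_0i$, $\lambda_3,\dots,\lambda_{2N}$ with $\beta_0>0$, and $\lambda_k/\lambda_1\notin\mathbb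 Z$ for all $k\ge3$. Then: 1. $\pm\beta_0i$ is a simple pair of eigenvalues of $J_{2N}H''(0)$, and both $\beta_0 i$ and $-\beta_0 i$ have algebraic multiplicity one. 2. $0$ is an isolated critical point of $H$ and its Brouwer index satisfies $\mathrm i_{\mathrm B}(0,H')=\pm1$. (The Brouwer index of an isolated zero of a $C^1$ map is its Brouwer degree over $0$ on any sufficiently small ball around the zero.) 3. The numbers $o_\pm=o_\pm(\beta_0,J_{2N}H''(0))$ and $e_\pm=e_\pm(\beta_0,J_{2N}H''(0))$ are the same for every normal form of $J_{2N}H''(0)$, and either $(o_+,o_-)=(1,0)$ or $(o_+,o_-)=(0,1)$, while $e_+=e_-=0$. In particular $o_+-o_-=\pm1$. 4. Consequently $$o_+-o_--e_++e_-\ne0 ,$$ and all assumptions of the generalized Lyapunov center theorem hold for $H$ on $\Omega$ and $\pm\beta_0i$: $\Omega$ is open, $H\in C^2(\Omega,\mathbb R)$, $0\in\Omega$ is an isolated critical point of $H$, $\mathrm i_{\mathrm B}(0,H')\neq0$, and $\pm\beta_0i$ with $\beta_0>0$ are eigenvalues of $J_{2N}H''(0)$ satisfying the displayed condition. -/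

import Mathlib

open Filter Topology

noncomputable section

namespace LyapunovCenter

/-! ## Hamiltonian and symplectic matrices -/

/-- Real `2n × 2n` matrices, written in `n × n` blocks. -/
abbrev Mat (n : ℕ) : Type := Matrix (Fin n ⊕ Fin n) (Fin n ⊕ Fin n) ℝ

/-- The standard symplectic matrix with blocks `0, Id, -Id, 0`. -/
def stdJ (n : ℕ) : Mat n := Matrix.fromBlocks 0 1 (-1) 0

/-- Mathlib's `Matrix.J` has the opposite sign, so that both define the same symplectic group. -/
theorem stdJ_eq (n : ℕ) : stdJ n = -Matrix.J (Fin n) ℝ := by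
  simp [stdJ, Matrix.J, Matrix.fromBlocks_neg]

/-- `M` is Hamiltonian (infinitesimally symplectic): `Mᵀ = J M J`. For the blocks `D, B, C, E` of
`M` this says that `B` and `C` are symmetric and `E = -Dᵀ`. -/
def IsHamiltonian {n : ℕ} (M : Mat n) : Prop :=
  M.transpose = stdJ n * M * stdJ n

/-- `M₂ = S⁻¹ M₁ S` for a symplectic matrix `S`. -/
def SymplecticallySimilar {n : ℕ} (M₁ M₂ : Mat n) : Prop :=
  ∃ S ∈ Matrix.symplecticGroup (Fin n) ℝ, M₂ = S⁻¹ * M₁ * S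

/-- A subspace on which the symplectic form `(v, w) ↦ vᵀ J w` is nondegenerate. -/
def IsSymplecticSubspace {n : ℕ} (V : Submodule ℝ (Fin n ⊕ Fin n → ℝ)) : Prop :=
  ∀ v ∈ V, (∀ w ∈ V, v ⬝ᵥ (stdJ n).mulVec w = 0) → v = 0

/-- The whole space is a direct sum of two proper, `M`-invariant, `J`-orthogonal symplectic
subspaces. -/
def IsDecomposable {n : ℕ} (M : Mat n) : Prop :=
  ∃ V₁ V₂ : Submodule ℝ (Fin n ⊕ Fin n → ℝ),
    IsCompl V₁ V₂ ∧ V₁ ≠ ⊤ ∧ V₂ ≠ ⊤ ∧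
    (∀ v ∈ V₁, M.mulVec v ∈ V₁) ∧ (∀ v ∈ V₂, M.mulVec v ∈ V₂) ∧
    (∀ v ∈ V₁, ∀ w ∈ V₂, v ⬝ᵥ (stdJ n).mulVec w = 0) ∧
    IsSymplecticSubspace V₁ ∧ IsSymplecticSubspace V₂

/-- The real matrix `M`, seen as a complex one. -/
def complexify {n : ℕ} (M : Mat n) : Matrix (Fin n ⊕ Fin n) (Fin n ⊕ Fin n) ℂ :=
  M.map (algebraMap ℝ ℂ)

/-- The set of complex eigenvalues `σ(M)`. -/
def complexSpectrum {n : ℕ} (M : Mat n) : Set ℂ := spectrum ℂ (complexify M)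

/-! ## The normal form at a purely imaginary pair of eigenvalues -/

/-- The normal form of an indecomposable block with spectrum `{± β i}` for odd `n`. With the rows
and columns numbered from `0`: `1` below the diagonal of the upper left block, `-1` above the
diagonal of the lower right block, and `∓ ε β` with alternating signs on the antidiagonals of the
two other blocks. For `n = 1` it has the rows `0, -ε β` and `ε β, 0`. -/
def oddBlock (n : ℕ) (β ε : ℝ) : Mat n :=
  let D : Matrix (Fin n) (Fin n) ℝ :=
    Matrix.of fun a b => if (a : ℕ) = b + 1 then 1 else 0
  let R : Matrix (Fin n) (Fin n) ℝ :=
    Matrix.of fun a b => if (a : ℕ) + b + 1 = n then (-1) ^ (a : ℕ) else 0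
  Matrix.fromBlocks D (-(ε * β) • R) ((ε * β) • R) (-D.transpose)

/-- The normal form of an indecomposable block with spectrum `{± β i}` for even `n`. The upper
left block has the `2 × 2` blocks with rows `0, -β` and `β, 0` on its diagonal and identities below
them, the lower left block has `ε` times the `2 × 2` identity in its lower right corner. -/
def evenBlock (n : ℕ) (β ε : ℝ) : Mat n :=
  let D : Matrix (Fin n) (Fin n) ℝ :=
    Matrix.of fun a b =>
      if (a : ℕ) = b + 2 then 1
      else if Even (b : ℕ) ∧ (a : ℕ) = b + 1 then β
      else if Even (a : ℕ) ∧ (b : ℕ) = a + 1 then -β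
      else 0
  let C : Matrix (Fin n) (Fin n) ℝ :=
    Matrix.of fun a b => if a = b ∧ n ≤ (a : ℕ) + 2 then ε else 0
  Matrix.fromBlocks D 0 C (-D.transpose)

/-- The matrix assembled from the blocks `M_j` with the sub-blocks `D_j, B_j, C_j, E_j`: its
blocks are `diag (D_j)`, `diag (B_j)`, `diag (C_j)` and `diag (E_j)`. -/
def assemble {s : ℕ} (n : Fin s → ℕ) (B : ∀ j, Mat (n j)) :
    Matrix ((Σ j, Fin (n j)) ⊕ (Σ j, Fin (n j))) ((Σ j, Fin (n j)) ⊕ (Σ j, Fin (n j))) ℝ :=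
  Matrix.fromBlocks
    (Matrix.blockDiagonal' fun j => (B j).toBlocks₁₁)
    (Matrix.blockDiagonal' fun j => (B j).toBlocks₁₂)
    (Matrix.blockDiagonal' fun j => (B j).toBlocks₂₁)
    (Matrix.blockDiagonal' fun j => (B j).toBlocks₂₂)

/-- A normal form of `M`, as far as it matters for the pair `± β i`: `M` is symplectically similar
to a matrix assembled from indecomposable Hamiltonian blocks, and every block with the eigenvalue
`β i` is one of the four standard ones (in particular its spectrum is `{± β i}`). The remaining
blocks enter none of the notions below, so they are left free. -/
structure NormalForm {N : ℕ} (β : ℝ) (M : Mat N) where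
  /-- the number of blocks -/
  s : ℕ
  /-- half the dimension of each block -/
  n : Fin s → ℕ
  /-- the blocks -/
  block : ∀ j, Mat (n j)
  n_pos : ∀ j, 0 < n j
  hamiltonian : ∀ j, IsHamiltonian (block j)
  indecomposable : ∀ j, ¬ IsDecomposable (block j)
  standard : ∀ j, (β * Complex.I : ℂ) ∈ complexSpectrum (block j) →
    ∃ ε : ℝ, (ε = 1 ∨ ε = -1) ∧
      ((Odd (n j) ∧ block j = oddBlock (n j) β ε) ∨
        (Even (n j) ∧ block j = evenBlock (n j) β ε))
  /-- the numbering of the coordinates; in particular `N` is the sum of the `n j` -/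
  coord : (Σ j, Fin (n j)) ≃ Fin N
  similar : SymplecticallySimilar M
    (Matrix.reindex (Equiv.sumCongr coord coord) (Equiv.sumCongr coord coord) (assemble n block))

open Classical in
/-- The number of odd blocks with sign `ε` in the normal form `F` for which `(N_j + 1) / 2` is
odd. -/
def NormalForm.numO {N : ℕ} {β : ℝ} {M : Mat N} (F : NormalForm β M) (ε : ℝ) : ℕ :=
  (Finset.univ.filter fun j =>
    Odd (F.n j) ∧ Odd ((F.n j + 1) / 2) ∧ F.block j = oddBlock (F.n j) β ε).card

open Classical in
/-- The number of odd blocks with sign `ε` in the normal form `F` for which `(N_j + 1) / 2` is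
even. -/
def NormalForm.numE {N : ℕ} {β : ℝ} {M : Mat N} (F : NormalForm β M) (ε : ℝ) : ℕ :=
  (Finset.univ.filter fun j =>
    Odd (F.n j) ∧ Even ((F.n j + 1) / 2) ∧ F.block j = oddBlock (F.n j) β ε).card

open Classical in
/-- `o_±(β, M)` for `ε = ± 1`, read off from a normal form of `M`. -/
def oNum {N : ℕ} (β : ℝ) (M : Mat N) (ε : ℝ) : ℕ :=
  if h : Nonempty (NormalForm β M) then h.some.numO ε else 0

open Classical in
/-- `e_±(β, M)` for `ε = ± 1`, read off from a normal form of `M`. -/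
def eNum {N : ℕ} (β : ℝ) (M : Mat N) (ε : ℝ) : ℕ :=
  if h : Nonempty (NormalForm β M) then h.some.numE ε else 0

/-- The pair `± β i` consists of eigenvalues of `M`, and in the normal form of `M` exactly one block
corresponds to it and is of dimension two. -/
def IsSimpleEigenvaluePair {N : ℕ} (β : ℝ) (M : Mat N) : Prop :=
  (β * Complex.I : ℂ) ∈ complexSpectrum M ∧ (-(β * Complex.I) : ℂ) ∈ complexSpectrum M ∧
  Nonempty (NormalForm β M) ∧
  ∀ F : NormalForm β M, ∃ j, F.n j = 1 ∧
    ∀ k, (β * Complex.I : ℂ) ∈ complexSpectrum (F.block k) ↔ k = j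

/-- `o_+ - o_- - e_+ + e_- ≠ 0`. -/
def SumCondition {N : ℕ} (β : ℝ) (M : Mat N) : Prop :=
  (oNum β M 1 : ℤ) - oNum β M (-1) - eNum β M 1 + eNum β M (-1) ≠ 0

/-- The nonresonance condition: the eigenvalues of `M`, listed with their algebraic
multiplicities, are `β i`, `-β i` and further ones, none of which is an integer multiple
of `β i`. -/
def Nonresonant {N : ℕ} (β : ℝ) (M : Mat N) : Prop :=
  0 < β ∧ ∃ rest : Multiset ℂ,
    (complexify M).charpoly.roots = (β * Complex.I) ::ₘ (-(β * Complex.I)) ::ₘ rest ∧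
    ∀ μ ∈ rest, ∀ k : ℤ, μ / (β * Complex.I) ≠ k

/-! ## The Brouwer index -/

/-- `d` is the Brouwer degree of the `C¹` map `f` on `U` over `y`: all regular values `z` close to
`y` have `d` preimages in `U`, counted with the signs of the Jacobian determinants. -/
def HasBrouwerDegree {ι : Type*} [Fintype ι] (f : EuclideanSpace ℝ ι → EuclideanSpace ℝ ι)
    (U : Set (EuclideanSpace ℝ ι)) (y : EuclideanSpace ℝ ι) (d : ℤ) : Prop :=
  ∀ᶠ z in 𝓝 y, (∀ x ∈ U, f x = z → (fderiv ℝ f x).det ≠ 0) →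
    ∑ᶠ (x) (_ : x ∈ U ∩ f ⁻¹' {z}), (SignType.sign (fderiv ℝ f x).det : ℤ) = d

/-- `x` is an isolated zero of `f`. -/
def IsIsolatedZero {ι : Type*} [Fintype ι] (f : EuclideanSpace ℝ ι → EuclideanSpace ℝ ι)
    (x : EuclideanSpace ℝ ι) : Prop :=
  f x = 0 ∧ ∀ᶠ y in 𝓝[≠] x, f y ≠ 0

/-- `d` is the Brouwer index of the isolated zero `x` of `f`, where `f` is `C¹` near `x`: the
degree over `0` on all small balls around `x`. -/
def HasBrouwerIndex {ι : Type*} [Fintype ι] (f : EuclideanSpace ℝ ι → EuclideanSpace ℝ ι)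
    (x : EuclideanSpace ℝ ι) (d : ℤ) : Prop :=
  ContDiffAt ℝ 1 f x ∧ IsIsolatedZero f x ∧
    ∀ᶠ r in 𝓝[>] (0 : ℝ), HasBrouwerDegree f (Metric.ball x r) 0 d

open Classical in
/-- The Brouwer index `i_B(x, f)` (with the value `0` where it is not defined). -/
def brouwerIndex {ι : Type*} [Fintype ι] (x : EuclideanSpace ℝ ι)
    (f : EuclideanSpace ℝ ι → EuclideanSpace ℝ ι) : ℤ :=
  if h : ∃ d, HasBrouwerIndex f x d then h.choose else 0

/-- The index is unique: by Sard's theorem there are regular values arbitrarily close to `0`. -/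
theorem HasBrouwerIndex.unique {ι : Type*} [Fintype ι]
    {f : EuclideanSpace ℝ ι → EuclideanSpace ℝ ι} {x : EuclideanSpace ℝ ι} {d d' : ℤ}
    (h : HasBrouwerIndex f x d) (h' : HasBrouwerIndex f x d') : d = d' := by
  obtain ⟨hf, -, h1⟩ := h
  obtain ⟨-, -, h2⟩ := h'
  obtain ⟨ρ, hρ, hdiff⟩ : ∃ ρ > 0, ∀ y ∈ Metric.ball x ρ, DifferentiableAt ℝ f y :=
    Metric.eventually_nhds_iff_ball.1
      ((hf.eventually (by simp)).mono fun y hy => hy.differentiableAt (by simp))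
  have h3 : ∀ᶠ r in 𝓝[>] (0 : ℝ), r < ρ :=
    (eventually_lt_nhds hρ).filter_mono nhdsWithin_le_nhds
  obtain ⟨r, ⟨hr1, hr2⟩, hr3⟩ := ((h1.and h2).and h3).exists
  have hnull : MeasureTheory.volume
      (f '' {y ∈ Metric.ball x r | (fderiv ℝ f y).det = 0}) = 0 :=
    MeasureTheory.addHaar_image_eq_zero_of_det_fderivWithin_eq_zero MeasureTheory.volume
      (fun y hy => (hdiff y (Metric.ball_subset_ball hr3.le hy.1)).hasFDerivAt.hasFDerivWithinAt)
      (fun y hy => hy.2)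
  have hdense := MeasureTheory.Measure.dense_of_ae (MeasureTheory.measure_eq_zero_iff_ae_notMem.1 hnull)
  have hfreq := mem_closure_iff_frequently.1 (hdense 0)
  obtain ⟨z, hz, hz1, hz2⟩ := (hfreq.and_eventually (hr1.and hr2)).exists
  have hreg : ∀ y ∈ Metric.ball x r, f y = z → (fderiv ℝ f y).det ≠ 0 :=
    fun y hy hyz h0 => hz ⟨y, ⟨hy, h0⟩, hyz⟩
  exact (hz1 hreg).symm.trans (hz2 hreg)

theorem HasBrouwerIndex.brouwerIndex_eq {ι : Type*} [Fintype ι]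
    {f : EuclideanSpace ℝ ι → EuclideanSpace ℝ ι} {x : EuclideanSpace ℝ ι} {d : ℤ}
    (h : HasBrouwerIndex f x d) : brouwerIndex x f = d := by
  have hex : ∃ d, HasBrouwerIndex f x d := ⟨d, h⟩
  rw [brouwerIndex, dif_pos hex]
  exact hex.choose_spec.unique h

/-! ## Hamiltonian functions -/

/-- The phase space `ℝ²ᴺ` with its Euclidean structure. -/
abbrev Phase (N : ℕ) : Type := EuclideanSpace ℝ (Fin N ⊕ Fin N)

/-- The Hessian matrix `H''(x)`: the Jacobian matrix of the gradient `H'`. -/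
def hessian {N : ℕ} (H : Phase N → ℝ) (x : Phase N) : Mat N :=
  Matrix.of fun i j => fderiv ℝ (gradient H) x (EuclideanSpace.single j 1) i

/-- The matrix `J H''(0)` of the system linearized at the origin. -/
def linearization {N : ℕ} (H : Phase N → ℝ) : Mat N := stdJ N * hessian H 0

/-- The assumptions of the generalized Lyapunov center theorem for the Hamiltonian `H` on `Ω` and
the pair `± β i`. -/
structure CenterTheoremAssumptions {N : ℕ} (Ω : Set (Phase N)) (H : Phase N → ℝ) (β : ℝ) :
    Prop where
  isOpen : IsOpen Ω
  contDiffOn : ContDiffOn ℝ 2 H Ω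
  zero_mem : (0 : Phase N) ∈ Ω
  isolated : IsIsolatedZero (gradient H) 0
  index_ne_zero : brouwerIndex 0 (gradient H) ≠ 0
  pos : 0 < β
  eigenvalue : (β * Complex.I : ℂ) ∈ complexSpectrum (linearization H)
  eigenvalue_neg : (-(β * Complex.I) : ℂ) ∈ complexSpectrum (linearization H)
  sum : SumCondition β (linearization H)

end LyapunovCenter

end

/-! The values `k = 0, 1, -1` in the nonresonance condition say that `J H''(0)` is invertible and
that `β i` and `-β i` are simple roots of the characteristic polynomial. Invertibility of the
Hessian settles the index: by the inverse function theorem the gradient is a local homeomorphism at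
`0`, and its degree there is the sign of `det H''(0)`.

For the normal form, `M = J H''(0)` is Hamiltonian because `H''(0)` is symmetric. The space is split
orthogonally into invariant symplectic subspaces that split no further, and Darboux bases turn `M`
on each of them into an indecomposable Hamiltonian block `B`. Let `β i` be an eigenvalue of `B`. The
operator `B² + β²` is self-adjoint for the symplectic form, so its kernel and range are orthogonal;
simplicity makes them complementary. Indecomposability leaves `B² = -β²`
(`quad_eq_zero_of_indecomposable`). Then `B x + i β x` is an eigenvector for every real `x`, and
since these are all proportional, `B` is of dimension two (`eq_one_of_indecomposable`). Such a `2 ×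
2` matrix is brought to the form `oddBlock 1 β ε` by hand. Blocks without the eigenvalue `β i` need
no treatment.

In an arbitrary normal form the eigenvector of `β i` lives in exactly one block, which is of
dimension two, so one number among `o_±` is `1` and the others vanish. The sign does not depend on
the normal form: `z̄ᵀ J z = -2 ε i` on an eigenvector read off from the block, symplectic changes of
coordinates preserve this form, and rescaling `z` by `c` multiplies it by `|c|² > 0`. -/

noncomputable section

namespace LyapunovCenter

/-! ### The Brouwer index of a nondegenerate zero -/

/-- The index of a nondegenerate zero is the sign of the Jacobian determinant. -/
theorem hasBrouwerIndex_of_det_ne_zero {ι : Type*} [Fintype ι]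
    {f : EuclideanSpace ℝ ι → EuclideanSpace ℝ ι} {x : EuclideanSpace ℝ ι}
    (hf : ContDiffAt ℝ 1 f x) (hx : f x = 0) (hdet : (fderiv ℝ f x).det ≠ 0) :
    HasBrouwerIndex f x (SignType.sign (fderiv ℝ f x).det : ℤ) := by
  classical
  let L : EuclideanSpace ℝ ι ≃L[ℝ] EuclideanSpace ℝ ι :=
    ContinuousLinearMap.toContinuousLinearEquivOfDetNeZero _ hdet
  have hL : HasFDerivAt f (L : EuclideanSpace ℝ ι →L[ℝ] EuclideanSpace ℝ ι) x := by
    rw [ContinuousLinearMap.coe_toContinuousLinearEquivOfDetNeZero]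
    exact (hf.differentiableAt (by simp)).hasFDerivAt
  -- The inverse function theorem: `f` is injective and open on `e.source`.
  obtain ⟨e, he, hxe⟩ : ∃ e : OpenPartialHomeomorph (EuclideanSpace ℝ ι) (EuclideanSpace ℝ ι),
      (e : EuclideanSpace ℝ ι → EuclideanSpace ℝ ι) = f ∧ x ∈ e.source :=
    ⟨hf.toOpenPartialHomeomorph f hL (by simp), hf.toOpenPartialHomeomorph_coe hL (by simp),
      hf.mem_toOpenPartialHomeomorph_source hL (by simp)⟩
  have hsrc : e.source ∈ 𝓝 x := e.open_source.mem_nhds hxe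
  have hinj : Set.InjOn f e.source := he ▸ e.injOn
  have hcont : ContinuousAt (fun y => (fderiv ℝ f y).det) x :=
    ContinuousLinearMap.continuous_det.continuousAt.comp (hf.continuousAt_fderiv (by simp))
  have hsign : ∀ᶠ y in 𝓝 x,
      SignType.sign (fderiv ℝ f y).det = SignType.sign (fderiv ℝ f x).det := by
    rcases lt_or_gt_of_ne hdet with h | h
    · filter_upwards [hcont.eventually_lt_const h] with y hy
      rw [sign_neg h, sign_neg hy]
    · filter_upwards [hcont.eventually_const_lt h] with y hy
      rw [sign_pos h, sign_pos hy]
  refine ⟨hf, ⟨hx, ?_⟩, ?_⟩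
  · rw [eventually_nhdsWithin_iff]
    filter_upwards [hsrc] with y hy hne h0
    exact hne (hinj hy hxe (h0.trans hx.symm))
  · obtain ⟨ρ, hρ, hball⟩ := Metric.eventually_nhds_iff_ball.1 (hsign.and hsrc)
    filter_upwards [(eventually_lt_nhds hρ).filter_mono nhdsWithin_le_nhds,
      self_mem_nhdsWithin] with r hr hr0
    have hsub : Metric.ball x r ⊆ e.source :=
      fun y hy => (hball y (Metric.ball_subset_ball hr.le hy)).2
    -- Every value close to `0` is attained in the ball, and by injectivity only once; the sum that
    -- defines the degree has a single term, whose sign is that at `x`.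
    have himg : f '' Metric.ball x r ∈ 𝓝 (0 : EuclideanSpace ℝ ι) := by
      rw [← hx, ← he, ← e.map_nhds_eq hxe]
      exact image_mem_map (Metric.ball_mem_nhds x hr0)
    filter_upwards [himg] with z hz _
    obtain ⟨y, hy, rfl⟩ := hz
    have : Metric.ball x r ∩ f ⁻¹' {f y} = {y} := by
      ext w
      simp only [Set.mem_inter_iff, Set.mem_preimage, Set.mem_singleton_iff]
      refine ⟨fun h => hinj (hsub h.1) (hsub hy) h.2, ?_⟩
      rintro rfl
      exact ⟨hy, rfl⟩
    rw [this, finsum_mem_singleton, (hball y (Metric.ball_subset_ball hr.le hy)).1]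

/-! ### The Hessian and the linearized system -/

theorem contDiffAt_gradient {N : ℕ} {H : Phase N → ℝ} {x : Phase N}
    (hH : ContDiffAt ℝ 2 H x) : ContDiffAt ℝ 1 (gradient H) x :=
  (InnerProductSpace.toDual ℝ (Phase N)).symm.contDiff.contDiffAt.comp x
    (hH.fderiv_right (m := 1) (by norm_num))

/-- The coordinates of the gradient are the partial derivatives of `H`. This reduces the symmetry of
the Hessian matrix to that of the second Fréchet derivative. -/
theorem hessian_apply {N : ℕ} {H : Phase N → ℝ} {x : Phase N} (hH : ContDiffAt ℝ 2 H x)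
    (i j : Fin N ⊕ Fin N) :
    hessian H x i j =
      fderiv ℝ (fderiv ℝ H) x (EuclideanSpace.single j 1) (EuclideanSpace.single i 1) := by
  have h1 : DifferentiableAt ℝ (fderiv ℝ H) x :=
    (hH.fderiv_right (m := 1) (by norm_num)).differentiableAt (by simp)
  have h2 : HasFDerivAt (fun y => gradient H y i)
      ((EuclideanSpace.proj i : Phase N →L[ℝ] ℝ).comp (fderiv ℝ (gradient H) x)) x :=
    (EuclideanSpace.proj i : Phase N →L[ℝ] ℝ).hasFDerivAt.comp x
      ((contDiffAt_gradient hH).differentiableAt (by simp)).hasFDerivAt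
  have h3 : HasFDerivAt (fun y => fderiv ℝ H y (EuclideanSpace.single i 1))
      ((fderiv ℝ (fderiv ℝ H) x).flip (EuclideanSpace.single i 1)) x := by
    simpa using h1.hasFDerivAt.clm_apply (hasFDerivAt_const (EuclideanSpace.single i (1 : ℝ)) x)
  have h4 : (fun y => gradient H y i) = fun y => fderiv ℝ H y (EuclideanSpace.single i 1) := by
    funext y
    rw [← InnerProductSpace.toDual_symm_apply, EuclideanSpace.inner_single_right]
    simp [gradient]
  rw [h4] at h2
  exact DFunLike.congr_fun (h2.unique h3) (EuclideanSpace.single j (1 : ℝ))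

theorem hessian_transpose {N : ℕ} {H : Phase N → ℝ} {x : Phase N} (hH : ContDiffAt ℝ 2 H x) :
    (hessian H x).transpose = hessian H x := by
  ext i j
  rw [Matrix.transpose_apply, hessian_apply hH, hessian_apply hH]
  exact (hH.isSymmSndFDerivAt (by simp)).eq _ _

theorem det_fderiv_gradient {N : ℕ} (H : Phase N → ℝ) (x : Phase N) :
    (fderiv ℝ (gradient H) x).det = (hessian H x).det := by
  have h := LinearMap.det_toMatrix (EuclideanSpace.basisFun (Fin N ⊕ Fin N) ℝ).toBasis
    (fderiv ℝ (gradient H) x : Phase N →ₗ[ℝ] Phase N)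
  rw [ContinuousLinearMap.det, ← h]
  congr 1

theorem transpose_stdJ (n : ℕ) : (stdJ n).transpose = -stdJ n := by
  simp [stdJ_eq, Matrix.J_transpose]

theorem stdJ_mul_stdJ (n : ℕ) : stdJ n * stdJ n = -1 := by
  simp [stdJ_eq, Matrix.J_squared]

theorem isHamiltonian_linearization {N : ℕ} {H : Phase N → ℝ} (hH : ContDiffAt ℝ 2 H 0) :
    IsHamiltonian (linearization H) := by
  rw [IsHamiltonian, linearization, Matrix.transpose_mul, hessian_transpose hH, transpose_stdJ,
    ← mul_assoc, stdJ_mul_stdJ]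
  simp

theorem det_linearization {N : ℕ} (H : Phase N → ℝ) :
    (linearization H).det ≠ 0 → (hessian H 0).det ≠ 0 := by
  intro h h0
  exact h (by rw [linearization, Matrix.det_mul, h0, mul_zero])

/-! ### Algebraic simplicity of the pair of eigenvalues -/

open Matrix

theorem mem_complexSpectrum_iff {n : ℕ} {M : Mat n} {μ : ℂ} :
    μ ∈ complexSpectrum M ↔ ∃ z ≠ 0, complexify M *ᵥ z = μ • z := by
  rw [complexSpectrum, ← Matrix.spectrum_toLin', ← Module.End.hasEigenvalue_iff_mem_spectrum]
  constructor
  · intro h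
    obtain ⟨z, hz⟩ := h.exists_hasEigenvector
    exact ⟨z, hz.2, by simpa using hz.apply_eq_smul⟩
  · rintro ⟨z, hz, h⟩
    exact Module.End.hasEigenvalue_of_hasEigenvector
      (Module.End.hasEigenvector_iff.2 ⟨Module.End.mem_eigenspace_iff.2 (by simpa using h), hz⟩)

/-- The quadratic factor `M² + β²` of the pair `± β i`. -/
def quad {n : ℕ} (β : ℝ) (M : Mat n) : Mat n := M * M + β ^ 2 • 1

/-- The geometric content of the algebraic simplicity of the pair `± β i`. -/
structure SemisimplePair {n : ℕ} (β : ℝ) (M : Mat n) : Prop where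
  quad_sq : ∀ y, quad β M *ᵥ (quad β M *ᵥ y) = 0 → quad β M *ᵥ y = 0
  proportional : ∀ z w, complexify M *ᵥ z = (β * Complex.I) • z →
    complexify M *ᵥ w = (β * Complex.I) • w → z ≠ 0 → ∃ c : ℂ, w = c • z

theorem finrank_maxGenEigenspace_toLin' {n : ℕ} (M : Mat n) (μ : ℂ) :
    Module.finrank ℂ (Module.End.maxGenEigenspace (Matrix.toLin' (complexify M)) μ) =
      (complexify M).charpoly.rootMultiplicity μ := by
  rw [LinearMap.finrank_maxGenEigenspace_eq, Matrix.charpoly_toLin']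

/-- The eigenspace is nonzero and lies in the generalized eigenspace, whose dimension is the
algebraic multiplicity. -/
theorem finrank_eigenspace_eq_one {n : ℕ} {M : Mat n} {μ : ℂ}
    (h : (complexify M).charpoly.rootMultiplicity μ = 1) :
    Module.finrank ℂ (Module.End.eigenspace (Matrix.toLin' (complexify M)) μ) = 1 := by
  have hle : Module.End.eigenspace (Matrix.toLin' (complexify M)) μ ≤
      Module.End.maxGenEigenspace (Matrix.toLin' (complexify M)) μ :=
    Module.End.genEigenspace_le_maximal _ μ 1
  refine le_antisymm ?_ ?_
  · rw [← h, ← finrank_maxGenEigenspace_toLin']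
    exact Submodule.finrank_mono hle
  · have hroot : (complexify M).charpoly.IsRoot μ := by
      by_contra h0
      rw [Polynomial.rootMultiplicity_eq_zero h0] at h
      exact zero_ne_one h
    have hev : Module.End.HasEigenvalue (Matrix.toLin' (complexify M)) μ := by
      rw [Module.End.hasEigenvalue_iff_isRoot_charpoly, Matrix.charpoly_toLin']
      exact hroot
    exact Submodule.one_le_finrank_iff.2 hev

/-- Eigenspace and generalized eigenspace are both lines, hence equal: there are no Jordan chains of
length two. -/
theorem eigenvector_of_sq {n : ℕ} {M : Mat n} {μ : ℂ}
    (h : (complexify M).charpoly.rootMultiplicity μ = 1) (z : Fin n ⊕ Fin n → ℂ)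
    (hz : (complexify M - μ • 1) *ᵥ ((complexify M - μ • 1) *ᵥ z) = 0) :
    (complexify M - μ • 1) *ᵥ z = 0 := by
  have hle : Module.End.eigenspace (Matrix.toLin' (complexify M)) μ ≤
      Module.End.maxGenEigenspace (Matrix.toLin' (complexify M)) μ :=
    Module.End.genEigenspace_le_maximal _ μ 1
  have heq := Submodule.eq_of_le_of_finrank_eq hle
    (by rw [finrank_eigenspace_eq_one h, finrank_maxGenEigenspace_toLin', h])
  have hmem : z ∈ Module.End.maxGenEigenspace (Matrix.toLin' (complexify M)) μ := by
    rw [Module.End.mem_maxGenEigenspace]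
    refine ⟨2, ?_⟩
    simpa [pow_two, sub_mulVec, smul_mulVec, LinearMap.sub_apply] using hz
  rw [← heq, Module.End.mem_eigenspace_iff] at hmem
  simpa [sub_mulVec, smul_mulVec, sub_eq_zero] using hmem

theorem complexify_mulVec_ofReal {m n : Type*} [Fintype n] (A : Matrix m n ℝ) (x : n → ℝ) :
    A.map (algebraMap ℝ ℂ) *ᵥ (fun i => (x i : ℂ)) = fun i => ((A *ᵥ x) i : ℂ) := by
  funext i
  simp [mulVec, dotProduct]

theorem complexify_quad_eq_add {n : ℕ} (β : ℝ) (M : Mat n) :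
    complexify (quad β M) = complexify M * complexify M + ((β : ℂ) ^ 2) • 1 := by
  rw [complexify, quad, Matrix.map_add _ (by simp), Matrix.map_mul]
  congr 1
  ext i j
  by_cases hij : i = j <;> simp [hij]

theorem complexify_quad {n : ℕ} (β : ℝ) (M : Mat n) :
    complexify (quad β M) = (complexify M - (β * Complex.I) • 1) *
      (complexify M - (-(β * Complex.I)) • 1) := by
  rw [complexify_quad_eq_add]
  simp only [sub_mul, smul_mul_assoc, mul_smul_comm, one_mul, mul_one, smul_smul,
    neg_smul, sub_neg_eq_add, smul_sub, mul_add]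
  have : (β * Complex.I) * (β * Complex.I) = -(β : ℂ) ^ 2 := by
    rw [mul_mul_mul_comm, Complex.I_mul_I]; ring
  rw [this, neg_smul]
  abel

/-- Over `ℂ`, `M² + β²` is the product of the commuting factors `M - β i` and `M + β i`, and
`eigenvector_of_sq` removes the repetition of each of them in turn. -/
theorem semisimplePair_of_rootMultiplicity {n : ℕ} {β : ℝ} {M : Mat n}
    (h1 : (complexify M).charpoly.rootMultiplicity (β * Complex.I) = 1)
    (h2 : (complexify M).charpoly.rootMultiplicity (-(β * Complex.I)) = 1) :
    SemisimplePair β M := by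
  constructor
  · intro y hy
    set P := complexify M - (β * Complex.I) • (1 : Matrix (Fin n ⊕ Fin n) (Fin n ⊕ Fin n) ℂ)
      with hP
    set Q := complexify M - (-(β * Complex.I)) • (1 : Matrix (Fin n ⊕ Fin n) (Fin n ⊕ Fin n) ℂ)
      with hQ
    have hPQ : P * Q = Q * P := by
      rw [hP, hQ]
      simp only [sub_mul, smul_mul_assoc, mul_smul_comm, one_mul, mul_one, neg_smul,
        sub_neg_eq_add, smul_sub, smul_add, mul_add, add_mul, mul_sub]
      abel
    have hreal : ∀ x : Fin n ⊕ Fin n → ℝ, (P * Q) *ᵥ (fun i => (x i : ℂ)) =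
        fun i => ((quad β M *ᵥ x) i : ℂ) := by
      intro x
      rw [← complexify_quad]
      exact complexify_mulVec_ofReal _ _
    set z : Fin n ⊕ Fin n → ℂ := fun i => (y i : ℂ) with hz
    have h0 : (P * Q) *ᵥ ((P * Q) *ᵥ z) = 0 := by
      rw [hz, hreal, hreal, hy]
      simp [funext_iff]
    have e1 : P *ᵥ (P *ᵥ (Q *ᵥ (Q *ᵥ z))) = 0 := by
      rw [← h0]
      simp only [mulVec_mulVec]
      congr 1
      rw [mul_assoc P Q, ← mul_assoc Q P Q, ← hPQ]
      simp only [mul_assoc]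
    have e2 : P *ᵥ (Q *ᵥ (Q *ᵥ z)) = 0 := eigenvector_of_sq h1 _ e1
    have e3 : Q *ᵥ (Q *ᵥ (P *ᵥ z)) = 0 := by
      rw [← e2]
      simp only [mulVec_mulVec]
      congr 1
      rw [← hPQ, ← mul_assoc, ← hPQ, mul_assoc]
    have e4 : Q *ᵥ (P *ᵥ z) = 0 := eigenvector_of_sq h2 _ e3
    have e5 : (P * Q) *ᵥ z = 0 := by
      rw [hPQ, ← mulVec_mulVec]
      exact e4
    rw [hz, hreal] at e5
    funext i
    simpa using congrFun e5 i
  · intro z w hz hw hz0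
    have hf := finrank_eigenspace_eq_one h1
    have hzm : z ∈ Module.End.eigenspace (Matrix.toLin' (complexify M)) (β * Complex.I) :=
      Module.End.mem_eigenspace_iff.2 (by simpa using hz)
    have hwm : w ∈ Module.End.eigenspace (Matrix.toLin' (complexify M)) (β * Complex.I) :=
      Module.End.mem_eigenspace_iff.2 (by simpa using hw)
    obtain ⟨c, hc⟩ := exists_smul_eq_of_finrank_eq_one hf (x := ⟨z, hzm⟩)
      (fun h => hz0 (congrArg Subtype.val h)) ⟨w, hwm⟩
    exact ⟨c, (congrArg Subtype.val hc).symm⟩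

namespace Nonresonant

variable {N : ℕ} {β : ℝ} {M : Mat N}

theorem mul_I_ne_zero (h : Nonresonant β M) : (β * Complex.I : ℂ) ≠ 0 := by
  simp [h.1.ne']

theorem rootMultiplicity (h : Nonresonant β M) :
    (complexify M).charpoly.rootMultiplicity (β * Complex.I) = 1 ∧
    (complexify M).charpoly.rootMultiplicity (-(β * Complex.I)) = 1 := by
  classical
  have h0 := h.mul_I_ne_zero
  have hne : (β * Complex.I : ℂ) ≠ -(β * Complex.I) := fun h => h0 (self_eq_neg.1 h)
  obtain ⟨-, rest, hr, hrest⟩ := h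
  -- The quotients would be `1` and `-1`, which nonresonance excludes.
  have n1 : (β * Complex.I : ℂ) ∉ rest := fun hm => hrest _ hm 1 (by simp [div_self h0])
  have n2 : -(β * Complex.I : ℂ) ∉ rest := fun hm => hrest _ hm (-1) (by simp [neg_div, div_self h0])
  rw [← Polynomial.count_roots, ← Polynomial.count_roots, hr]
  simp [hne, hne.symm, n1, n2]

/-- An eigenvalue `0` would have to be among the remaining ones, where the quotient `0` is excluded.
-/
theorem det_ne_zero (h : Nonresonant β M) : M.det ≠ 0 := by
  intro hd
  have h0 := h.mul_I_ne_zero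
  obtain ⟨-, rest, hr, hrest⟩ := h
  have hroot : (0 : ℂ) ∈ (complexify M).charpoly.roots := by
    rw [Polynomial.mem_roots (Matrix.charpoly_monic _).ne_zero, Polynomial.IsRoot,
      Matrix.eval_charpoly, map_zero, zero_sub, Matrix.det_neg]
    have : (complexify M).det = 0 := by
      rw [complexify, ← RingHom.mapMatrix_apply, ← RingHom.map_det, hd, map_zero]
    rw [this, mul_zero]
  rw [hr, Multiset.mem_cons, Multiset.mem_cons] at hroot
  rcases hroot with h1 | h1 | h1
  · exact h0 h1.symm
  · exact h0 (neg_eq_zero.1 h1.symm)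
  · exact hrest 0 h1 0 (by simp)

theorem semisimplePair (h : Nonresonant β M) : SemisimplePair β M :=
  semisimplePair_of_rootMultiplicity h.rootMultiplicity.1 h.rootMultiplicity.2

end Nonresonant

theorem mem_complexSpectrum_of_rootMultiplicity {n : ℕ} {M : Mat n} {μ : ℂ}
    (h : (complexify M).charpoly.rootMultiplicity μ = 1) : μ ∈ complexSpectrum M := by
  rw [complexSpectrum, Matrix.mem_spectrum_iff_isRoot_charpoly]
  by_contra h0
  rw [Polynomial.rootMultiplicity_eq_zero h0] at h
  exact zero_ne_one h

/-! ### The symplectic form, Darboux bases and orthogonal splittings -/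

/-- The symplectic form `(v, w) ↦ vᵀ J w`. -/
def sympForm (n : ℕ) : LinearMap.BilinForm ℝ (Fin n ⊕ Fin n → ℝ) := Matrix.toBilin' (stdJ n)

theorem sympForm_apply {n : ℕ} (v w : Fin n ⊕ Fin n → ℝ) :
    sympForm n v w = v ⬝ᵥ (stdJ n).mulVec w := by
  rw [sympForm, Matrix.toBilin'_apply']

theorem sympForm_swap {n : ℕ} (v w : Fin n ⊕ Fin n → ℝ) :
    sympForm n v w = -sympForm n w v := by
  rw [sympForm_apply, sympForm_apply, dotProduct_mulVec, dotProduct_comm, ← mulVec_transpose,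
    transpose_stdJ, neg_mulVec, dotProduct_neg]

theorem sympForm_self {n : ℕ} (v : Fin n ⊕ Fin n → ℝ) : sympForm n v v = 0 :=
  self_eq_neg.1 (sympForm_swap v v)

theorem eq_zero_of_sympForm {n : ℕ} {v : Fin n ⊕ Fin n → ℝ} (h : ∀ w, sympForm n v w = 0) :
    v = 0 := by
  have h1 : ∀ w, v ⬝ᵥ w = 0 := by
    intro w
    have := h (-(stdJ n *ᵥ w))
    rwa [sympForm_apply, mulVec_neg, mulVec_mulVec, stdJ_mul_stdJ, neg_mulVec, neg_neg,
      one_mulVec] at this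
  exact dotProduct_eq_zero v h1

theorem sympForm_mulVec_left {n : ℕ} {M : Mat n} (hM : IsHamiltonian M)
    (v w : Fin n ⊕ Fin n → ℝ) : sympForm n (M *ᵥ v) w = -sympForm n v (M *ᵥ w) := by
  rw [sympForm_apply, sympForm_apply, dotProduct_comm, dotProduct_mulVec, ← mulVec_transpose,
    hM, dotProduct_comm, mulVec_mulVec, mul_assoc, stdJ_mul_stdJ, mulVec_mulVec]
  simp [neg_mulVec]

/-- Darboux bases of symplectic subspaces. -/
theorem exists_darboux_vectors {N : ℕ} (k : ℕ) :
    ∀ W : Submodule ℝ (Fin N ⊕ Fin N → ℝ), Module.finrank ℝ W = k → IsSymplecticSubspace W →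
    ∃ (n : ℕ) (p q : Fin n → (Fin N ⊕ Fin N → ℝ)), (∀ a, p a ∈ W) ∧ (∀ a, q a ∈ W) ∧
      (∀ a b, sympForm N (p a) (p b) = 0) ∧ (∀ a b, sympForm N (q a) (q b) = 0) ∧
      (∀ a b, sympForm N (p a) (q b) = if a = b then 1 else 0) ∧
      ∀ v ∈ W, v = ∑ a, (sympForm N v (q a) • p a - sympForm N v (p a) • q a) := by
  induction k using Nat.strong_induction_on with
  | _ k ih =>
  intro W hk hW
  by_cases hbot : W = ⊥
  · subst hbot
    exact ⟨0, Fin.elim0, Fin.elim0, fun a => a.elim0, fun a => a.elim0, fun a => a.elim0,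
      fun a => a.elim0, fun a => a.elim0, fun v hv => by simpa using hv⟩
  obtain ⟨v, hv, hv0⟩ := Submodule.exists_mem_ne_zero_of_ne_bot hbot
  obtain ⟨w₀, hw₀, hvw₀⟩ : ∃ w ∈ W, sympForm N v w ≠ 0 := by
    by_contra! h
    exact hv0 (hW v hv fun w hw => by rw [← sympForm_apply]; exact h w hw)
  obtain ⟨w, hw, hvw⟩ : ∃ w ∈ W, sympForm N v w = 1 :=
    ⟨(sympForm N v w₀)⁻¹ • w₀, W.smul_mem _ hw₀, by simp [hvw₀]⟩
  -- The pair `v, w` spans a hyperbolic plane; the induction continues in its orthogonal complement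
  -- `W'` in `W`.
  have hwv : sympForm N w v = -1 := by rw [sympForm_swap, hvw]
  let W' := W ⊓ LinearMap.ker (sympForm N v) ⊓ LinearMap.ker (sympForm N w)
  have hmem : ∀ x, x ∈ W' ↔ (x ∈ W ∧ sympForm N v x = 0) ∧ sympForm N w x = 0 := fun x => Iff.rfl
  have hle : W' ≤ W := fun x hx => hx.1.1
  have hlt : W' < W := by
    refine lt_of_le_of_ne hle fun h => ?_
    have : v ∈ W' := h ▸ hv
    rw [hmem, hwv] at this
    norm_num at this
  -- The orthogonal projection of `W` onto `W'`. Pairing with an element of `W'` does not notice it,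
  -- so the form stays nondegenerate on `W'`.
  have hproj : ∀ y ∈ W, y - (sympForm N y w • v - sympForm N y v • w) ∈ W' := by
    intro y hy
    refine ⟨⟨W.sub_mem hy (W.sub_mem (W.smul_mem _ hv) (W.smul_mem _ hw)), ?_⟩, ?_⟩
    · simp [sympForm_self, hvw, sympForm_swap v y]
    · simp [sympForm_self, hwv, sympForm_swap w y]
  have hW' : IsSymplecticSubspace W' := by
    intro x hx h
    refine hW x (hle hx) fun y hy => ?_
    have h1 := h _ (hproj y hy)
    rw [← sympForm_apply] at h1 ⊢
    rw [hmem] at hx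
    simpa [sympForm_swap x v, sympForm_swap x w, hx.1.2, hx.2] using h1
  obtain ⟨n, p, q, hp, hq, hpp, hqq, hpq, hsum⟩ :=
    ih _ (hk ▸ Submodule.finrank_lt_finrank_of_lt hlt) W' rfl hW'
  have hvp : ∀ a, sympForm N v (p a) = 0 := fun a => (hp a).1.2
  have hvq : ∀ a, sympForm N v (q a) = 0 := fun a => (hq a).1.2
  have hwp : ∀ a, sympForm N w (p a) = 0 := fun a => (hp a).2
  have hwq : ∀ a, sympForm N w (q a) = 0 := fun a => (hq a).2
  have hpv : ∀ a, sympForm N (p a) v = 0 := fun a => by rw [sympForm_swap, hvp, neg_zero]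
  have hqv : ∀ a, sympForm N (q a) v = 0 := fun a => by rw [sympForm_swap, hvq, neg_zero]
  have hpw : ∀ a, sympForm N (p a) w = 0 := fun a => by rw [sympForm_swap, hwp, neg_zero]
  have hqw : ∀ a, sympForm N (q a) w = 0 := fun a => by rw [sympForm_swap, hwq, neg_zero]
  refine ⟨n + 1, Fin.cons v p, Fin.cons w q, ?_, ?_, ?_, ?_, ?_, ?_⟩
  · exact Fin.cases hv fun a => hle (hp a)
  · exact Fin.cases hw fun a => hle (hq a)
  · intro a b
    cases a using Fin.cases <;> cases b using Fin.cases <;> simp [sympForm_self, hvp, hpv, hpp]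
  · intro a b
    cases a using Fin.cases <;> cases b using Fin.cases <;> simp [sympForm_self, hwq, hqw, hqq]
  · intro a b
    cases a using Fin.cases <;> cases b using Fin.cases <;>
      simp [hvw, hvq, hpw, hpq, Fin.succ_ne_zero, (Fin.succ_ne_zero _).symm]
  · intro y hy
    have h1 := hsum _ (hproj y hy)
    simp only [map_sub, map_smul, LinearMap.sub_apply, LinearMap.smul_apply, hvp, hvq, hwp, hwq,
      smul_zero, sub_zero] at h1
    rw [Fin.sum_univ_succ]
    simp only [Fin.cons_zero, Fin.cons_succ]
    rw [← h1]
    abel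

/-- `E` has the columns of a Darboux basis of its range. -/
def IsSymplecticFrame {N n : ℕ} (E : Matrix (Fin N ⊕ Fin N) (Fin n ⊕ Fin n) ℝ) : Prop :=
  Eᵀ * stdJ N * E = stdJ n

theorem transpose_mul_stdJ_mul_apply {N : ℕ} {ι κ : Type*} (E : Matrix (Fin N ⊕ Fin N) ι ℝ)
    (F : Matrix (Fin N ⊕ Fin N) κ ℝ) (c : ι) (d : κ) :
    (Eᵀ * stdJ N * F) c d = sympForm N (E.col c) (F.col d) := by
  rw [sympForm_apply, Matrix.mul_assoc, Matrix.mul_apply]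
  rfl

theorem exists_symplecticFrame {N : ℕ} {W : Submodule ℝ (Fin N ⊕ Fin N → ℝ)}
    (hW : IsSymplecticSubspace W) :
    ∃ (n : ℕ) (E : Matrix (Fin N ⊕ Fin N) (Fin n ⊕ Fin n) ℝ), IsSymplecticFrame E ∧
      LinearMap.range E.mulVecLin = W := by
  obtain ⟨n, p, q, hp, hq, hpp, hqq, hpq, hsum⟩ := exists_darboux_vectors _ W rfl hW
  let E : Matrix (Fin N ⊕ Fin N) (Fin n ⊕ Fin n) ℝ := Matrix.of fun i c => Sum.elim p q c i
  have hcol : ∀ c, E.col c = Sum.elim p q c := fun c => rfl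
  refine ⟨n, E, ?_, ?_⟩
  · ext c d
    rw [transpose_mul_stdJ_mul_apply, hcol, hcol]
    rcases c with a | a <;> rcases d with b | b
    · simp [hpp, stdJ]
    · simp [hpq, stdJ, Matrix.one_apply]
    · rw [sympForm_swap]
      simp [hpq, stdJ, Matrix.one_apply, eq_comm]
    · simp [hqq, stdJ]
  · rw [Matrix.range_mulVecLin]
    apply le_antisymm
    · rw [Submodule.span_le]
      rintro _ ⟨c, rfl⟩
      rw [hcol]
      rcases c with a | a
      exacts [hp a, hq a]
    · intro v hv
      rw [hsum v hv]
      refine Submodule.sum_mem _ fun a _ => Submodule.sub_mem _ (Submodule.smul_mem _ _ ?_)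
        (Submodule.smul_mem _ _ ?_)
      · exact Submodule.subset_span ⟨Sum.inl a, rfl⟩
      · exact Submodule.subset_span ⟨Sum.inr a, rfl⟩

/-- `W` is an orthogonal sum of two proper `M`-invariant subspaces. -/
def Splits {N : ℕ} (M : Mat N) (W : Submodule ℝ (Fin N ⊕ Fin N → ℝ)) : Prop :=
  ∃ W₁ W₂ : Submodule ℝ (Fin N ⊕ Fin N → ℝ), W₁ ⊔ W₂ = W ∧ W₁ ≠ W ∧ W₂ ≠ W ∧
    (∀ v ∈ W₁, M *ᵥ v ∈ W₁) ∧ (∀ v ∈ W₂, M *ᵥ v ∈ W₂) ∧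
    ∀ v ∈ W₁, ∀ w ∈ W₂, sympForm N v w = 0

/-- A vector of `W₁` orthogonal to `W₁` is orthogonal to the whole sum. For this reason `Splits`
need not demand that its summands be symplectic. -/
theorem IsSymplecticSubspace.of_sup {N : ℕ} {W₁ W₂ : Submodule ℝ (Fin N ⊕ Fin N → ℝ)}
    (h : IsSymplecticSubspace (W₁ ⊔ W₂)) (horth : ∀ v ∈ W₁, ∀ w ∈ W₂, sympForm N v w = 0) :
    IsSymplecticSubspace W₁ := by
  intro v hv h1
  refine h v (Submodule.mem_sup_left hv) fun w hw => ?_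
  obtain ⟨w₁, hw₁, w₂, hw₂, rfl⟩ := Submodule.mem_sup.1 hw
  have h2 := h1 w₁ hw₁
  rw [← sympForm_apply] at h2 ⊢
  rw [map_add, h2, horth v hv w₂ hw₂, add_zero]

/-- Every invariant symplectic subspace is an orthogonal sum of nonzero invariant symplectic
subspaces that do not split. -/
theorem exists_orthogonal_decomposition {N : ℕ} (M : Mat N) (k : ℕ) :
    ∀ W : Submodule ℝ (Fin N ⊕ Fin N → ℝ), Module.finrank ℝ W = k → IsSymplecticSubspace W →
    (∀ v ∈ W, M *ᵥ v ∈ W) →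
    ∃ S : Finset (Submodule ℝ (Fin N ⊕ Fin N → ℝ)), S.sup id = W ∧
      (∀ U ∈ S, U ≠ ⊥ ∧ IsSymplecticSubspace U ∧ (∀ v ∈ U, M *ᵥ v ∈ U) ∧ ¬ Splits M U) ∧
      ∀ U ∈ S, ∀ U' ∈ S, U ≠ U' → ∀ v ∈ U, ∀ w ∈ U', sympForm N v w = 0 := by
  classical
  induction k using Nat.strong_induction_on with
  | _ k ih =>
  intro W hk hW hinv
  by_cases hbot : W = ⊥
  · exact ⟨∅, by simp [hbot], by simp, by simp⟩
  by_cases hs : Splits M W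
  · obtain ⟨W₁, W₂, rfl, h1, h2, hi1, hi2, horth⟩ := hs
    have horth' : ∀ v ∈ W₂, ∀ w ∈ W₁, sympForm N v w = 0 := fun v hv w hw => by
      rw [sympForm_swap, horth w hw v hv, neg_zero]
    have hl1 : W₁ < W₁ ⊔ W₂ := lt_of_le_of_ne le_sup_left h1
    have hl2 : W₂ < W₁ ⊔ W₂ := lt_of_le_of_ne le_sup_right h2
    obtain ⟨S₁, hS₁, hU₁, ho₁⟩ := ih _ (hk ▸ Submodule.finrank_lt_finrank_of_lt hl1) W₁ rfl
      (hW.of_sup horth) hi1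
    obtain ⟨S₂, hS₂, hU₂, ho₂⟩ := ih _ (hk ▸ Submodule.finrank_lt_finrank_of_lt hl2) W₂ rfl
      (IsSymplecticSubspace.of_sup (sup_comm W₁ W₂ ▸ hW) horth') hi2
    have hle1 : ∀ U ∈ S₁, U ≤ W₁ := fun U hU => hS₁ ▸ Finset.le_sup (f := id) hU
    have hle2 : ∀ U ∈ S₂, U ≤ W₂ := fun U hU => hS₂ ▸ Finset.le_sup (f := id) hU
    refine ⟨S₁ ∪ S₂, by rw [Finset.sup_union, hS₁, hS₂], ?_, ?_⟩
    · intro U hU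
      exact (Finset.mem_union.1 hU).elim (hU₁ U) (hU₂ U)
    · intro U hU U' hU' hne v hv w hw
      rcases Finset.mem_union.1 hU with h | h <;> rcases Finset.mem_union.1 hU' with h' | h'
      · exact ho₁ U h U' h' hne v hv w hw
      · exact horth v (hle1 U h hv) w (hle2 U' h' hw)
      · exact horth' v (hle2 U h hv) w (hle1 U' h' hw)
      · exact ho₂ U h U' h' hne v hv w hw
  · refine ⟨{W}, by simp, ?_, ?_⟩
    · intro U hU
      rw [Finset.mem_singleton.1 hU]
      exact ⟨hbot, hW, hinv, hs⟩
    · intro U hU U' hU' hne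
      exact absurd ((Finset.mem_singleton.1 hU).trans (Finset.mem_singleton.1 hU').symm) hne

/-! ### Restriction to symplectic frames -/

namespace IsSymplecticFrame

variable {N n : ℕ} {E : Matrix (Fin N ⊕ Fin N) (Fin n ⊕ Fin n) ℝ}

/-- The symplectic adjoint of a frame is its left inverse, because `J² = -1`. It yields injectivity
over `ℝ` and over `ℂ`, and the projections to the blocks of a normal form. -/
theorem leftInverse_mul (hE : IsSymplecticFrame E) : -(stdJ n * Eᵀ * stdJ N) * E = 1 := by
  rw [Matrix.neg_mul, Matrix.mul_assoc, Matrix.mul_assoc, ← Matrix.mul_assoc Eᵀ, hE, stdJ_mul_stdJ, neg_neg]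

theorem mul_left_cancel (hE : IsSymplecticFrame E) {κ : Type*}
    {A B : Matrix (Fin n ⊕ Fin n) κ ℝ} (h : E * A = E * B) : A = B := by
  have := congrArg (fun X => -(stdJ n * Eᵀ * stdJ N) * X) h
  simpa only [← Matrix.mul_assoc, hE.leftInverse_mul, Matrix.one_mul] using this

theorem mulVec_injective (hE : IsSymplecticFrame E) : Function.Injective (E *ᵥ ·) := by
  intro v w h
  have := congrArg (fun X => -(stdJ n * Eᵀ * stdJ N) *ᵥ X) h
  simpa only [mulVec_mulVec, hE.leftInverse_mul, one_mulVec] using this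

theorem map_mulVec_injective (hE : IsSymplecticFrame E) :
    Function.Injective (E.map (algebraMap ℝ ℂ) *ᵥ ·) := by
  intro v w h
  have h1 : (-(stdJ n * Eᵀ * stdJ N)).map (algebraMap ℝ ℂ) * E.map (algebraMap ℝ ℂ) = 1 := by
    rw [← Matrix.map_mul, hE.leftInverse_mul, Matrix.map_one _ (map_zero _) (map_one _)]
  have := congrArg (fun X => (-(stdJ n * Eᵀ * stdJ N)).map (algebraMap ℝ ℂ) *ᵥ X) h
  simpa only [mulVec_mulVec, h1, one_mulVec] using this

theorem sympForm_mulVec (hE : IsSymplecticFrame E) (v w : Fin n ⊕ Fin n → ℝ) :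
    sympForm N (E *ᵥ v) (E *ᵥ w) = sympForm n v w := by
  rw [sympForm_apply, sympForm_apply, dotProduct_comm, dotProduct_mulVec, ← mulVec_transpose,
    mulVec_mulVec, mulVec_mulVec, hE, dotProduct_comm]

end IsSymplecticFrame

/-- The block is the left inverse of `E` applied to `M E`. Being Hamiltonian means that `J M` is
symmetric, which passes to `Eᵀ (J M) E`, and the block is `-J` times this matrix. -/
theorem exists_block_of_frame {N n : ℕ} {M : Mat N} (hM : IsHamiltonian M)
    {E : Matrix (Fin N ⊕ Fin N) (Fin n ⊕ Fin n) ℝ} (hE : IsSymplecticFrame E)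
    (hinv : ∀ v ∈ LinearMap.range E.mulVecLin, M *ᵥ v ∈ LinearMap.range E.mulVecLin) :
    ∃ B : Mat n, M * E = E * B ∧ IsHamiltonian B := by
  refine ⟨-(stdJ n * Eᵀ * stdJ N) * (M * E), ?_, ?_⟩
  · refine (Matrix.ext_of_mulVec_single fun c => ?_)
    obtain ⟨w, hw⟩ := hinv (E *ᵥ Pi.single c 1) ⟨_, rfl⟩
    rw [Matrix.mulVecLin_apply] at hw
    rw [← mulVec_mulVec, ← mulVec_mulVec, ← mulVec_mulVec, ← mulVec_mulVec, ← hw,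
      mulVec_mulVec w, hE.leftInverse_mul, one_mulVec]
  · have hK : (Eᵀ * (stdJ N * M) * E)ᵀ = Eᵀ * (stdJ N * M) * E := by
      rw [transpose_mul, transpose_mul, transpose_mul, transpose_transpose, transpose_stdJ, hM,
        mul_neg, mul_assoc (stdJ N * M), stdJ_mul_stdJ]
      simp [Matrix.mul_assoc]
    have hB : -(stdJ n * Eᵀ * stdJ N) * (M * E) = -(stdJ n * (Eᵀ * (stdJ N * M) * E)) := by
      simp [Matrix.mul_assoc]
    rw [IsHamiltonian, hB, transpose_neg, transpose_mul, hK, transpose_stdJ, mul_neg, mul_neg,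
      ← Matrix.mul_assoc (stdJ n), stdJ_mul_stdJ]
    simp

theorem splits_of_isDecomposable {N n : ℕ} {M : Mat N}
    {E : Matrix (Fin N ⊕ Fin N) (Fin n ⊕ Fin n) ℝ} (hE : IsSymplecticFrame E) {B : Mat n}
    (hB : M * E = E * B) (hdec : IsDecomposable B) : Splits M (LinearMap.range E.mulVecLin) := by
  obtain ⟨V₁, V₂, hc, h1, h2, hi1, hi2, ho, -, -⟩ := hdec
  have hinj : Function.Injective E.mulVecLin := hE.mulVec_injective
  have hinv : ∀ V : Submodule ℝ (Fin n ⊕ Fin n → ℝ), (∀ v ∈ V, B *ᵥ v ∈ V) →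
      ∀ v ∈ V.map E.mulVecLin, M *ᵥ v ∈ V.map E.mulVecLin := by
    rintro V hV _ ⟨w, hw, rfl⟩
    exact ⟨B *ᵥ w, hV w hw, by simp [hB]⟩
  have hne : ∀ V : Submodule ℝ (Fin n ⊕ Fin n → ℝ), V ≠ ⊤ →
      V.map E.mulVecLin ≠ LinearMap.range E.mulVecLin := by
    intro V hV h
    rw [LinearMap.range_eq_map] at h
    exact hV (Submodule.map_injective_of_injective hinj h)
  refine ⟨V₁.map E.mulVecLin, V₂.map E.mulVecLin, ?_, hne _ h1, hne _ h2, hinv _ hi1, hinv _ hi2,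
    ?_⟩
  · rw [← Submodule.map_sup, hc.sup_eq_top, LinearMap.range_eq_map]
  · rintro _ ⟨v, hv, rfl⟩ _ ⟨w, hw, rfl⟩
    rw [Matrix.mulVecLin_apply, Matrix.mulVecLin_apply, hE.sympForm_mulVec, sympForm_apply]
    exact ho v hv w hw

theorem complexify_mul_frame {N n : ℕ} {M : Mat N}
    {E : Matrix (Fin N ⊕ Fin N) (Fin n ⊕ Fin n) ℝ} {B : Mat n} (hB : M * E = E * B)
    (z : Fin n ⊕ Fin n → ℂ) :
    complexify M *ᵥ (E.map (algebraMap ℝ ℂ) *ᵥ z) =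
      E.map (algebraMap ℝ ℂ) *ᵥ (complexify B *ᵥ z) := by
  rw [mulVec_mulVec, mulVec_mulVec, complexify, complexify, ← Matrix.map_mul, hB, Matrix.map_mul]

/-- `E` is injective and intertwines `B` with `M`, so kernels and eigenvectors of `B` embed into
those of `M`. -/
theorem SemisimplePair.of_frame {N n : ℕ} {β : ℝ} {M : Mat N} (h : SemisimplePair β M)
    {E : Matrix (Fin N ⊕ Fin N) (Fin n ⊕ Fin n) ℝ} (hE : IsSymplecticFrame E) {B : Mat n}
    (hB : M * E = E * B) : SemisimplePair β B := by
  have hq : quad β M * E = E * quad β B := by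
    rw [quad, quad, Matrix.add_mul, Matrix.mul_add, Matrix.mul_assoc, hB, ← Matrix.mul_assoc, hB,
      Matrix.mul_assoc]
    simp
  constructor
  · intro y hy
    have h1 := h.quad_sq (E *ᵥ y)
    rw [mulVec_mulVec y, hq, ← mulVec_mulVec, mulVec_mulVec _ _ E, hq, ← mulVec_mulVec, hy,
      mulVec_zero] at h1
    exact hE.mulVec_injective (by simpa using h1 rfl)
  · intro z w hz hw hz0
    obtain ⟨c, hc⟩ := h.proportional (E.map (algebraMap ℝ ℂ) *ᵥ z) (E.map (algebraMap ℝ ℂ) *ᵥ w)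
      (by rw [complexify_mul_frame hB, hz, mulVec_smul])
      (by rw [complexify_mul_frame hB, hw, mulVec_smul])
      (fun h0 => hz0 (hE.map_mulVec_injective (by simpa using h0)))
    exact ⟨c, hE.map_mulVec_injective (by simpa [mulVec_smul] using hc)⟩

/-! ### Indecomposable blocks with the simple pair -/

theorem mulVec_re_im {m n : Type*} [Fintype n] (A : Matrix m n ℝ) (z : n → ℂ) (i : m) :
    (A.map (algebraMap ℝ ℂ) *ᵥ z) i =
      ((A *ᵥ fun j => (z j).re) i : ℂ) + ((A *ᵥ fun j => (z j).im) i : ℂ) * Complex.I := by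
  simp only [mulVec, dotProduct, Matrix.map_apply, Complex.coe_algebraMap, Complex.ofReal_sum,
    Finset.sum_mul, ← Finset.sum_add_distrib, Complex.ofReal_mul]
  refine Finset.sum_congr rfl fun j _ => ?_
  conv_lhs => rw [← Complex.re_add_im (z j)]
  ring

/-- The real matrix `B² + β²` annihilates the real and the imaginary part of an eigenvector of `β
i`, and one of them is nonzero. -/
theorem exists_ker_quad {n : ℕ} {β : ℝ} {B : Mat n}
    (h : (β * Complex.I : ℂ) ∈ complexSpectrum B) : ∃ x ≠ 0, quad β B *ᵥ x = 0 := by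
  obtain ⟨z, hz0, hz⟩ := mem_complexSpectrum_iff.1 h
  have h1 : complexify (quad β B) *ᵥ z = 0 := by
    rw [complexify_quad_eq_add, add_mulVec, ← mulVec_mulVec, hz, mulVec_smul, hz, smul_smul,
      mul_mul_mul_comm, Complex.I_mul_I, smul_mulVec, one_mulVec, ← add_smul]
    ring_nf
    simp
  have h2 : ∀ i, (quad β B *ᵥ fun j => (z j).re) i = 0 ∧ (quad β B *ᵥ fun j => (z j).im) i = 0 := by
    intro i
    have := congrFun h1 i
    rw [complexify, mulVec_re_im] at this
    simpa [Complex.ext_iff] using this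
  by_cases hre : (fun j => (z j).re) = 0
  · refine ⟨fun j => (z j).im, fun him => hz0 ?_, funext fun i => (h2 i).2⟩
    funext j
    exact Complex.ext (congrFun hre j) (congrFun him j)
  · exact ⟨_, hre, funext fun i => (h2 i).1⟩

/-- `B` is skew for the symplectic form, so `B²` is self-adjoint. -/
theorem sympForm_quad {n : ℕ} {β : ℝ} {B : Mat n} (hB : IsHamiltonian B)
    (v w : Fin n ⊕ Fin n → ℝ) :
    sympForm n (quad β B *ᵥ v) w = sympForm n v (quad β B *ᵥ w) := by
  simp only [quad, add_mulVec, ← mulVec_mulVec, smul_mulVec, one_mulVec, map_add,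
    LinearMap.add_apply, sympForm_mulVec_left hB, map_smul, LinearMap.smul_apply, neg_neg]

theorem isSymplecticSubspace_top (n : ℕ) :
    IsSymplecticSubspace (⊤ : Submodule ℝ (Fin n ⊕ Fin n → ℝ)) := fun v _ h =>
  eq_zero_of_sympForm fun w => by rw [sympForm_apply]; exact h w trivial

theorem quad_mul_comm {n : ℕ} (β : ℝ) (B : Mat n) : quad β B * B = B * quad β B := by
  simp [quad, add_mul, mul_add, mul_assoc]

/-- An indecomposable matrix with the simple pair `± β i` satisfies `B² = -β²`. -/
theorem quad_eq_zero_of_indecomposable {n : ℕ} {β : ℝ} {B : Mat n} (hB : IsHamiltonian B)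
    (hs : SemisimplePair β B) (hind : ¬ IsDecomposable B)
    (h : (β * Complex.I : ℂ) ∈ complexSpectrum B) : quad β B = 0 := by
  obtain ⟨x, hx0, hx⟩ := exists_ker_quad h
  let K := LinearMap.ker (quad β B).mulVecLin
  let R := LinearMap.range (quad β B).mulVecLin
  -- By `quad_sq`, an element of the range killed by `B² + β²` is zero; counting dimensions then
  -- makes kernel and range complementary.
  have hdisj : Disjoint K R := by
    rw [Submodule.disjoint_def]
    rintro _ hv ⟨y, rfl⟩
    exact hs.quad_sq y hv
  have hsup : K ⊔ R = ⊤ := Submodule.eq_top_of_disjoint K R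
    (by rw [add_comm, LinearMap.finrank_range_add_finrank_ker]) hdisj
  have horth : ∀ v ∈ K, ∀ w ∈ R, sympForm n v w = 0 := by
    rintro v hv _ ⟨y, rfl⟩
    have hv' : quad β B *ᵥ v = 0 := hv
    rw [Matrix.mulVecLin_apply, ← sympForm_quad hB, hv', map_zero, LinearMap.zero_apply]
  have horth' : ∀ v ∈ R, ∀ w ∈ K, sympForm n v w = 0 := fun v hv w hw => by
    rw [sympForm_swap, horth w hw v hv, neg_zero]
  have hRtop : R ≠ ⊤ := by
    intro hR
    have : x ∈ K ⊓ R := ⟨hx, hR ▸ Submodule.mem_top⟩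
    rw [hdisj.eq_bot] at this
    exact hx0 this
  have hKtop : K = ⊤ := by
    by_contra hK
    refine hind ⟨K, R, ⟨hdisj, codisjoint_iff.2 hsup⟩, hK, hRtop, ?_, ?_, ?_, ?_, ?_⟩
    · intro v hv
      have hv' : quad β B *ᵥ v = 0 := hv
      change quad β B *ᵥ (B *ᵥ v) = 0
      rw [mulVec_mulVec, quad_mul_comm, ← mulVec_mulVec, hv', mulVec_zero]
    · rintro _ ⟨y, rfl⟩
      exact ⟨B *ᵥ y, by simp [quad_mul_comm]⟩
    · intro v hv w hw
      rw [← sympForm_apply]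
      exact horth v hv w hw
    · exact IsSymplecticSubspace.of_sup (hsup ▸ isSymplecticSubspace_top n) horth
    · exact IsSymplecticSubspace.of_sup (sup_comm K R ▸ hsup ▸ isSymplecticSubspace_top n) horth'
  refine Matrix.ext_of_mulVec_single fun i => ?_
  have : Pi.single i 1 ∈ K := hKtop ▸ Submodule.mem_top
  rw [zero_mulVec]
  exact this

/-- `(B - β i)(B + β i) x = 0`. -/
theorem eigenvector_of_quad_eq_zero {n : ℕ} {β : ℝ} {B : Mat n} (hq : quad β B = 0)
    (x : Fin n ⊕ Fin n → ℝ) :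
    complexify B *ᵥ (fun i => ((B *ᵥ x) i : ℂ) + (β * Complex.I) * x i) =
      (β * Complex.I) • fun i => ((B *ᵥ x) i : ℂ) + (β * Complex.I) * x i := by
  have h1 : B *ᵥ (B *ᵥ x) = -(β ^ 2 • x) := by
    have := congrArg (· *ᵥ x) hq
    simp only [quad, add_mulVec, ← mulVec_mulVec, smul_mulVec, one_mulVec, zero_mulVec] at this
    exact eq_neg_of_add_eq_zero_left this
  have h2 : (fun i => ((B *ᵥ x) i : ℂ) + (β * Complex.I) * x i) =
      (fun i => ((B *ᵥ x) i : ℂ)) + (β * Complex.I) • fun i => (x i : ℂ) := rfl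
  rw [h2, mulVec_add, mulVec_smul, complexify, complexify_mulVec_ofReal, complexify_mulVec_ofReal,
    h1]
  funext i
  simp only [Pi.add_apply, Pi.smul_apply, Pi.neg_apply, smul_eq_mul, Complex.ofReal_neg,
    Complex.ofReal_mul, Complex.ofReal_pow]
  linear_combination (-(β : ℂ) ^ 2 * x i) * Complex.I_sq

/-- An indecomposable block with the simple pair `± β i` is of dimension two. -/
theorem eq_one_of_indecomposable {n : ℕ} {β : ℝ} (hβ : 0 < β) {B : Mat n} (hB : IsHamiltonian B)
    (hs : SemisimplePair β B) (hind : ¬ IsDecomposable B)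
    (h : (β * Complex.I : ℂ) ∈ complexSpectrum B) : n = 1 := by
  classical
  have hq := quad_eq_zero_of_indecomposable hB hs hind h
  obtain ⟨x, hx0, -⟩ := exists_ker_quad h
  have hn : n ≠ 0 := by
    rintro rfl
    exact hx0 (Subsingleton.elim _ _)
  have hne : (fun i => ((B *ᵥ x) i : ℂ) + (β * Complex.I) * x i) ≠ 0 := by
    intro h0
    refine hx0 (funext fun i => ?_)
    have := congrArg Complex.im (congrFun h0 i)
    simpa [hβ.ne'] using this
  have hspan : Submodule.span ℝ
      (({x, B *ᵥ x} : Finset (Fin n ⊕ Fin n → ℝ)) : Set (Fin n ⊕ Fin n → ℝ)) = ⊤ := by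
    rw [eq_top_iff]
    intro y _
    -- The imaginary part of `B y + i β y = c (B x + i β x)` reads `β y = Im c • B x + β Re c • x`,
    -- so `x` and `B x` span the real space.
    obtain ⟨c, hc⟩ := hs.proportional _ _ (eigenvector_of_quad_eq_zero hq x)
      (eigenvector_of_quad_eq_zero hq y) hne
    rw [Finset.coe_pair, Submodule.mem_span_pair]
    refine ⟨c.re, β⁻¹ * c.im, funext fun i => ?_⟩
    have := congrArg Complex.im (congrFun hc i)
    simp only [Complex.add_im, Complex.ofReal_im, Complex.mul_im, Complex.mul_re, Complex.ofReal_re,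
      Complex.I_re, Complex.I_im, Pi.smul_apply, smul_eq_mul, Complex.add_re] at this
    simp only [Pi.add_apply, Pi.smul_apply, smul_eq_mul]
    field_simp
    linarith
  have hcard := finrank_span_finset_le_card (R := ℝ) ({x, B *ᵥ x} : Finset (Fin n ⊕ Fin n → ℝ))
  rw [Set.finrank, hspan, finrank_top, Module.finrank_fintype_fun_eq_card, Fintype.card_sum,
    Fintype.card_fin] at hcard
  have := hcard.trans Finset.card_le_two
  omega

/-! ### Standard form of the two-dimensional blocks -/

/-- Two-dimensional blocks with `B² = -β²` in normal form. -/
theorem exists_frame_oddBlock {β : ℝ} (hβ : 0 < β) {B : Mat 1} (hB : IsHamiltonian B)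
    (hq : quad β B = 0) : ∃ ε : ℝ, (ε = 1 ∨ ε = -1) ∧ ∃ S : Mat 1, IsSymplecticFrame S ∧
      B * S = S * oddBlock 1 β ε := by
  obtain ⟨a, ha⟩ : ∃ a, B (Sum.inl 0) (Sum.inl 0) = a := ⟨_, rfl⟩
  obtain ⟨b, hb⟩ : ∃ b, B (Sum.inl 0) (Sum.inr 0) = b := ⟨_, rfl⟩
  obtain ⟨c, hc⟩ : ∃ c, B (Sum.inr 0) (Sum.inl 0) = c := ⟨_, rfl⟩
  have hd : B (Sum.inr 0) (Sum.inr 0) = -a := by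
    have := congrFun (congrFun hB (Sum.inl 0)) (Sum.inl 0)
    simp [stdJ, Matrix.mul_apply, ha] at this
    linarith
  have habc : a * a + b * c + β ^ 2 = 0 := by
    have := congrFun (congrFun hq (Sum.inl 0)) (Sum.inl 0)
    simpa [quad, Matrix.mul_apply, ha, hb, hc] using this
  -- Otherwise `a² + β² = 0`. The sign `ε` is that of `c`.
  have hc0 : c ≠ 0 := by
    rintro rfl
    nlinarith [sq_nonneg a, pow_pos hβ 2]
  obtain ⟨ε, hε, hεc⟩ : ∃ ε : ℝ, (ε = 1 ∨ ε = -1) ∧ 0 < ε * c := by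
    rcases lt_or_gt_of_ne hc0 with h | h
    · exact ⟨-1, Or.inr rfl, by linarith⟩
    · exact ⟨1, Or.inl rfl, by linarith⟩
  have hεε : ε * ε = 1 := by rcases hε with rfl | rfl <;> norm_num
  have hε0 : ε ≠ 0 := left_ne_zero_of_mul_eq_one hεε
  obtain ⟨t, ht⟩ : ∃ t : ℝ, t * t * (ε * c) = β := by
    refine ⟨√(β / (ε * c)), ?_⟩
    rw [Real.mul_self_sqrt (by positivity)]
    field_simp
  -- The first column is `t e₁`, and the standard form forces the second to be `(ε / β) B (t e₁)`.
  -- Their symplectic product is `t² ε c / β`, which is `1` by the choice of `t`.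
  refine ⟨ε, hε, Matrix.fromBlocks (Matrix.of fun _ _ => t) (Matrix.of fun _ _ => t * a * ε / β) 0
    (Matrix.of fun _ _ => t * c * ε / β), ?_, ?_⟩
  · rw [IsSymplecticFrame]
    ext i j
    rcases i with i | i <;> rcases j with j | j <;> fin_cases i <;> fin_cases j <;>
      simp [stdJ, Matrix.mul_apply] <;> field_simp <;> linarith
  · ext i j
    rcases i with i | i <;> rcases j with j | j <;> fin_cases i <;> fin_cases j <;>
      simp [oddBlock, Matrix.mul_apply, ha, hb, hc, hd] <;> field_simp
    · linear_combination (-(a * t)) * hεε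
    · linear_combination t * habc
    · linear_combination (-t) * hεε
    · ring

/-- The normal form condition on a single block. -/
def IsStandard {n : ℕ} (β : ℝ) (B : Mat n) : Prop :=
  (β * Complex.I : ℂ) ∈ complexSpectrum B → ∃ ε : ℝ, (ε = 1 ∨ ε = -1) ∧
    ((Odd n ∧ B = oddBlock n β ε) ∨ (Even n ∧ B = evenBlock n β ε))

theorem IsSymplecticFrame.mul {N n : ℕ} {E : Matrix (Fin N ⊕ Fin N) (Fin n ⊕ Fin n) ℝ}
    (hE : IsSymplecticFrame E) {S : Mat n} (hS : IsSymplecticFrame S) :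
    IsSymplecticFrame (E * S) := by
  rw [IsSymplecticFrame, transpose_mul, Matrix.mul_assoc Sᵀ, Matrix.mul_assoc Sᵀ,
    ← Matrix.mul_assoc _ E, hE, ← Matrix.mul_assoc, hS]

theorem IsSymplecticFrame.range_mul {N n : ℕ} {E : Matrix (Fin N ⊕ Fin N) (Fin n ⊕ Fin n) ℝ}
    {S : Mat n} (hS : IsSymplecticFrame S) :
    LinearMap.range (E * S).mulVecLin = LinearMap.range E.mulVecLin := by
  rw [Matrix.mulVecLin_mul, LinearMap.range_comp_of_range_eq_top]
  exact LinearMap.range_eq_top.2 (LinearMap.surjective_of_injective hS.mulVec_injective)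

/-- A nonzero invariant symplectic subspace that does not split carries a standard block. -/
theorem exists_standard_block {N : ℕ} {β : ℝ} (hβ : 0 < β) {M : Mat N} (hM : IsHamiltonian M)
    (hs : SemisimplePair β M) {U : Submodule ℝ (Fin N ⊕ Fin N → ℝ)} (hU : U ≠ ⊥)
    (hsymp : IsSymplecticSubspace U) (hinv : ∀ v ∈ U, M *ᵥ v ∈ U) (hsplit : ¬ Splits M U) :
    ∃ (n : ℕ) (E : Matrix (Fin N ⊕ Fin N) (Fin n ⊕ Fin n) ℝ) (B : Mat n), IsSymplecticFrame E ∧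
      LinearMap.range E.mulVecLin = U ∧ M * E = E * B ∧ 0 < n ∧ IsHamiltonian B ∧
      ¬ IsDecomposable B ∧ IsStandard β B := by
  obtain ⟨n, E, hE, hr⟩ := exists_symplecticFrame hsymp
  have hn : 0 < n := by
    rcases Nat.eq_zero_or_pos n with rfl | h
    · refine absurd ?_ hU
      rw [← hr, LinearMap.range_eq_bot]
      ext x
      exact x.elim Fin.elim0 Fin.elim0
    · exact h
  obtain ⟨B, hB, hH⟩ := exists_block_of_frame hM hE (hr ▸ hinv)
  have hind : ¬ IsDecomposable B := fun h => hsplit (hr ▸ splits_of_isDecomposable hE hB h)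
  by_cases hspec : (β * Complex.I : ℂ) ∈ complexSpectrum B
  · have hsB := hs.of_frame hE hB
    obtain rfl := eq_one_of_indecomposable hβ hH hsB hind hspec
    obtain ⟨ε, hε, S, hS, hBS⟩ :=
      exists_frame_oddBlock hβ hH (quad_eq_zero_of_indecomposable hH hsB hind hspec)
    have hES := hE.mul hS
    have hrS : LinearMap.range (E * S).mulVecLin = U := hS.range_mul.trans hr
    -- The block is taken anew in the frame `E * S`, so that it is Hamiltonian and indecomposable
    -- for general reasons; only afterwards is it identified with `oddBlock 1 β ε`.
    obtain ⟨B', hB', hH'⟩ := exists_block_of_frame hM hES (hrS ▸ hinv)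
    have hB'O : B' = oddBlock 1 β ε := hES.mul_left_cancel
      (by rw [← hB', ← Matrix.mul_assoc, hB, Matrix.mul_assoc, hBS, Matrix.mul_assoc])
    exact ⟨1, E * S, B', hES, hrS, hB', one_pos, hH',
      fun h => hsplit (hrS ▸ splits_of_isDecomposable hES hB' h),
      fun _ => ⟨ε, hε, Or.inl ⟨odd_one, hB'O⟩⟩⟩
  · exact ⟨n, E, B, hE, hr, hB, hn, hH, hind, fun h => absurd h hspec⟩

/-! ### Assembling blocks into a normal form -/

/-- The coordinates of the block with the number `j`. -/
def blockIncl {s : ℕ} (n : Fin s → ℕ) (j : Fin s) :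
    Fin (n j) ⊕ Fin (n j) → (Σ j, Fin (n j)) ⊕ (Σ j, Fin (n j)) :=
  Sum.map (fun a => ⟨j, a⟩) (fun a => ⟨j, a⟩)

@[simp]
theorem blockIncl_inl {s : ℕ} (n : Fin s → ℕ) (j : Fin s) (a : Fin (n j)) :
    blockIncl n j (Sum.inl a) = Sum.inl ⟨j, a⟩ := rfl

@[simp]
theorem blockIncl_inr {s : ℕ} (n : Fin s → ℕ) (j : Fin s) (a : Fin (n j)) :
    blockIncl n j (Sum.inr a) = Sum.inr ⟨j, a⟩ := rfl

theorem exists_eq_blockIncl {s : ℕ} {n : Fin s → ℕ} (c : (Σ j, Fin (n j)) ⊕ (Σ j, Fin (n j))) :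
    ∃ j c', c = blockIncl n j c' := by
  rcases c with ⟨j, a⟩ | ⟨j, a⟩
  exacts [⟨j, Sum.inl a, rfl⟩, ⟨j, Sum.inr a, rfl⟩]

/-- The columns of `F` that belong to the block with the number `j`. -/
def blockColumns {m : Type*} {s : ℕ} {n : Fin s → ℕ} {α : Type*}
    (F : Matrix m ((Σ j, Fin (n j)) ⊕ (Σ j, Fin (n j))) α) (j : Fin s) :
    Matrix m (Fin (n j) ⊕ Fin (n j)) α :=
  F.submatrix id (blockIncl n j)

theorem eq_of_blockColumns_eq {m : Type*} {s : ℕ} {n : Fin s → ℕ} {α : Type*}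
    {F G : Matrix m ((Σ j, Fin (n j)) ⊕ (Σ j, Fin (n j))) α}
    (h : ∀ j, blockColumns F j = blockColumns G j) : F = G := by
  ext i c
  rcases c with ⟨j, a⟩ | ⟨j, a⟩
  · exact congrFun (congrFun (h j) i) (Sum.inl a)
  · exact congrFun (congrFun (h j) i) (Sum.inr a)

theorem blockColumns_mul {l m : Type*} [Fintype m] {s : ℕ} {n : Fin s → ℕ} (A : Matrix l m ℝ)
    (F : Matrix m ((Σ j, Fin (n j)) ⊕ (Σ j, Fin (n j))) ℝ) (j : Fin s) :
    blockColumns (A * F) j = A * blockColumns F j := rfl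

/-- Since the assembled matrix does not mix blocks, `M F = F * assemble n B` can be checked frame by
frame. -/
theorem blockColumns_mul_assemble {m : Type*} {s : ℕ} {n : Fin s → ℕ}
    (F : Matrix m ((Σ j, Fin (n j)) ⊕ (Σ j, Fin (n j))) ℝ) (B : ∀ j, Mat (n j)) (j : Fin s) :
    blockColumns (F * assemble n B) j = blockColumns F j * B j := by
  have key : ∀ (f : (Σ j, Fin (n j)) → ℝ) (D : ∀ j, Matrix (Fin (n j)) (Fin (n j)) ℝ)
      (b : Fin (n j)), ∑ x, f x * Matrix.blockDiagonal' D x ⟨j, b⟩ =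
        ∑ a, f ⟨j, a⟩ * D j a b := by
    intro f D b
    rw [Fintype.sum_sigma, Finset.sum_eq_single j]
    · simp
    · intro k _ hk
      refine Finset.sum_eq_zero fun a _ => ?_
      rw [Matrix.blockDiagonal'_apply_ne _ _ _ hk, mul_zero]
    · simp
  ext i c
  rcases c with b | b
  · simp [blockColumns, assemble, Matrix.mul_apply, key, Matrix.toBlocks₁₁, Matrix.toBlocks₂₁]
  · simp [blockColumns, assemble, Matrix.mul_apply, key, Matrix.toBlocks₁₂, Matrix.toBlocks₂₂]

/-- The standard symplectic matrix in coordinates numbered by any finite type. -/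
theorem stdJ_submatrix {N : ℕ} {ι : Type*} [DecidableEq ι] (e : ι ≃ Fin N) :
    (stdJ N).submatrix (Equiv.sumCongr e e) (Equiv.sumCongr e e) =
      (Matrix.fromBlocks 0 1 (-1) 0 : Matrix (ι ⊕ ι) (ι ⊕ ι) ℝ) := by
  ext c d
  rcases c with c | c <;> rcases d with d | d <;> simp [stdJ, Matrix.one_apply]

theorem mem_symplecticGroup_iff {N : ℕ} {S : Mat N} :
    S ∈ Matrix.symplecticGroup (Fin N) ℝ ↔ Sᵀ * stdJ N * S = stdJ N := by
  rw [SymplecticGroup.mem_iff', stdJ_eq]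
  simp

theorem mem_symplecticGroup_iff' {N : ℕ} {S : Mat N} :
    S ∈ Matrix.symplecticGroup (Fin N) ℝ ↔ S * stdJ N * Sᵀ = stdJ N := by
  rw [SymplecticGroup.mem_iff, stdJ_eq]
  simp

/-- Blocks in pairwise orthogonal symplectic frames that span the space form a normal form. -/
theorem nonempty_normalForm_of_frames {N : ℕ} {β : ℝ} {M : Mat N} {s : ℕ} {n : Fin s → ℕ}
    (E : ∀ j, Matrix (Fin N ⊕ Fin N) (Fin (n j) ⊕ Fin (n j)) ℝ) (B : ∀ j, Mat (n j))
    (hn : ∀ j, 0 < n j) (hH : ∀ j, IsHamiltonian (B j)) (hind : ∀ j, ¬ IsDecomposable (B j))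
    (hstd : ∀ j, IsStandard β (B j)) (hE : ∀ j, IsSymplecticFrame (E j))
    (horth : ∀ j k, j ≠ k → (E j)ᵀ * stdJ N * E k = 0)
    (hspan : ⨆ j, LinearMap.range (E j).mulVecLin = ⊤) (hB : ∀ j, M * E j = E j * B j) :
    Nonempty (NormalForm β M) := by
  classical
  let F : Matrix (Fin N ⊕ Fin N) ((Σ j, Fin (n j)) ⊕ (Σ j, Fin (n j))) ℝ :=
    Matrix.of fun i => Sum.elim (fun x => E x.1 i (Sum.inl x.2)) (fun x => E x.1 i (Sum.inr x.2))
  have hcols : ∀ j, blockColumns F j = E j := by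
    intro j
    ext i c
    rcases c with c | c <;> rfl
  have hMF : M * F = F * assemble n B :=
    eq_of_blockColumns_eq fun j => by
      rw [blockColumns_mul, blockColumns_mul_assemble, hcols, hB]
  have hFF : Fᵀ * stdJ N * F = Matrix.fromBlocks 0 1 (-1) 0 := by
    have hjk : ∀ j k (c : Fin (n j) ⊕ Fin (n j)) (d : Fin (n k) ⊕ Fin (n k)),
        (Fᵀ * stdJ N * F) (blockIncl n j c)
          (blockIncl n k d) = ((E j)ᵀ * stdJ N * E k) c d := by
      intro j k c d
      rw [← hcols, ← hcols]
      rfl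
    ext c d
    obtain ⟨j, c, rfl⟩ := exists_eq_blockIncl c
    obtain ⟨k, d, rfl⟩ := exists_eq_blockIncl d
    rw [hjk]
    by_cases h : j = k
    · subst h
      rw [hE j]
      rcases c with c | c <;> rcases d with d | d <;> simp [stdJ, Matrix.one_apply]
    · rw [horth j k h]
      rcases c with c | c <;> rcases d with d | d <;> simp [h]
  -- `F` is injective since its Gram matrix is invertible, and surjective since the frames span.
  -- This gives `∑ n j = N`, hence a numbering of the coordinates.
  have hinj : Function.Injective F.mulVecLin := by
    let K : Matrix ((Σ j, Fin (n j)) ⊕ (Σ j, Fin (n j))) ((Σ j, Fin (n j)) ⊕ (Σ j, Fin (n j))) ℝ :=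
      Matrix.fromBlocks 0 (-1) 1 0
    have h1 : (K * Fᵀ * stdJ N) * F = 1 := by
      rw [Matrix.mul_assoc K, Matrix.mul_assoc K, hFF, Matrix.fromBlocks_multiply]
      simp [← Matrix.fromBlocks_one]
    intro v w h
    have := congrArg ((K * Fᵀ * stdJ N) *ᵥ ·) h
    simpa only [Matrix.mulVecLin_apply, mulVec_mulVec, h1, one_mulVec] using this
  have hsurj : Function.Surjective F.mulVecLin := by
    rw [← LinearMap.range_eq_top, eq_top_iff, ← hspan, iSup_le_iff]
    intro j
    rw [Matrix.range_mulVecLin, Matrix.range_mulVecLin, ← hcols]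
    refine Submodule.span_mono ?_
    rintro _ ⟨c, rfl⟩
    exact ⟨blockIncl n j c, rfl⟩
  have hcard : Fintype.card (Σ j, Fin (n j)) = N := by
    have := (LinearEquiv.ofBijective F.mulVecLin ⟨hinj, hsurj⟩).finrank_eq
    rw [Module.finrank_fintype_fun_eq_card, Module.finrank_fintype_fun_eq_card, Fintype.card_sum,
      Fintype.card_sum, Fintype.card_fin] at this
    omega
  let coord := Fintype.equivFinOfCardEq hcard
  let e := Equiv.sumCongr coord coord
  have hS : F.submatrix id e.symm ∈ Matrix.symplecticGroup (Fin N) ℝ := by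
    rw [mem_symplecticGroup_iff]
    have h1 : (F.submatrix id e.symm)ᵀ * stdJ N * F.submatrix id e.symm =
        (Fᵀ * stdJ N * F).submatrix e.symm e.symm := rfl
    rw [h1, hFF, ← stdJ_submatrix coord, Matrix.submatrix_submatrix]
    change (stdJ N).submatrix (e ∘ e.symm) (e ∘ e.symm) = _
    rw [Equiv.self_comp_symm, Matrix.submatrix_id_id]
  refine ⟨⟨s, n, B, hn, hH, hind, hstd, coord, F.submatrix id e.symm, hS, ?_⟩⟩
  have h2 : M * F.submatrix id e.symm =
      F.submatrix id e.symm * Matrix.reindex e e (assemble n B) := by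
    rw [Matrix.reindex_apply, Matrix.submatrix_mul_equiv, ← hMF]
    rfl
  rw [mul_assoc, h2, ← mul_assoc, Matrix.nonsing_inv_mul _ (SymplecticGroup.symplectic_det hS),
    one_mul]

theorem nonempty_normalForm {N : ℕ} {β : ℝ} (hβ : 0 < β) {M : Mat N} (hM : IsHamiltonian M)
    (hs : SemisimplePair β M) : Nonempty (NormalForm β M) := by
  obtain ⟨S, htop, hU, ho⟩ := exists_orthogonal_decomposition M _ ⊤ rfl
    (isSymplecticSubspace_top N) (fun _ _ => trivial)
  have hblock := fun j : Fin S.card => exists_standard_block hβ hM hs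
    (hU _ (S.equivFin.symm j).2).1 (hU _ (S.equivFin.symm j).2).2.1
    (hU _ (S.equivFin.symm j).2).2.2.1 (hU _ (S.equivFin.symm j).2).2.2.2
  choose n E B hE hr hB hn hH hind hstd using hblock
  refine nonempty_normalForm_of_frames E B hn hH hind hstd hE ?_ ?_ hB
  · intro j k hjk
    ext c d
    rw [transpose_mul_stdJ_mul_apply]
    refine ho _ (S.equivFin.symm j).2 _ (S.equivFin.symm k).2 ?_ _ ?_ _ ?_
    · exact fun h => hjk (S.equivFin.symm.injective (Subtype.ext h))
    · rw [← hr j]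
      exact ⟨Pi.single c 1, by simp⟩
    · rw [← hr k]
      exact ⟨Pi.single d 1, by simp⟩
  · simp only [hr]
    rw [eq_top_iff, ← htop]
    refine Finset.sup_le fun U hUS => ?_
    refine le_iSup_of_le (S.equivFin ⟨U, hUS⟩) ?_
    simp

/-! ### The sign carried by an eigenvector -/

/-- The Hermitian form `z̄ᵀ J z` (up to the factor `i`). -/
def krein (n : ℕ) (z : Fin n ⊕ Fin n → ℂ) : ℂ := star z ⬝ᵥ (complexify (stdJ n) *ᵥ z)

/-- The factor is nonnegative, so the sign of the form is the same on all nonzero multiples of an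
eigenvector. -/
theorem krein_smul {n : ℕ} (c : ℂ) (z : Fin n ⊕ Fin n → ℂ) :
    krein n (c • z) = (Complex.normSq c : ℂ) * krein n z := by
  rw [krein, krein, mulVec_smul, star_smul, smul_dotProduct, dotProduct_smul, smul_smul,
    Complex.normSq_eq_conj_mul_self, smul_eq_mul]
  rfl

theorem krein_frame {N n : ℕ} {E : Matrix (Fin N ⊕ Fin N) (Fin n ⊕ Fin n) ℝ}
    (hE : IsSymplecticFrame E) (z : Fin n ⊕ Fin n → ℂ) :
    krein N (E.map (algebraMap ℝ ℂ) *ᵥ z) = krein n z := by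
  have h1 : (E.map (algebraMap ℝ ℂ))ᴴ = Eᵀ.map (algebraMap ℝ ℂ) := by
    ext i j
    simp
  rw [krein, krein, star_mulVec, h1, ← dotProduct_mulVec, mulVec_mulVec, mulVec_mulVec,
    complexify, complexify, ← Matrix.map_mul, ← Matrix.map_mul, hE]

/-- Odd standard blocks have the eigenvalue `β i`, with the eigenvector `(e_{n-1}, -i ε e₀)`. -/
theorem oddBlock_eigenvector {n : ℕ} (hn : Odd n) (β : ℝ) {ε : ℝ} (hε : ε = 1 ∨ ε = -1) :
    complexify (oddBlock n β ε) *ᵥ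
        (Sum.elim (Pi.single (Fin.mk (n - 1) (Nat.sub_lt hn.pos one_pos)) 1)
          (Pi.single (Fin.mk 0 hn.pos) (-(ε * Complex.I)))) =
      (β * Complex.I) •
        (Sum.elim (Pi.single (Fin.mk (n - 1) (Nat.sub_lt hn.pos one_pos)) 1)
          (Pi.single (Fin.mk 0 hn.pos) (-(ε * Complex.I)))) := by
  have hpos := hn.pos
  have hεε : (ε : ℂ) * ε = 1 := by rcases hε with rfl | rfl <;> norm_num
  have hpow : (-1 : ℂ) ^ (n - 1) = 1 := (Nat.Odd.sub_odd hn odd_one).neg_one_pow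
  rw [complexify, oddBlock, Matrix.fromBlocks_map, Matrix.fromBlocks_mulVec]
  funext c
  rcases c with a | a
  · by_cases ha : (a : ℕ) = n - 1
    · have : a = ⟨n - 1, Nat.sub_lt hpos one_pos⟩ := Fin.ext ha
      subst this
      have h1 : ¬ (n - 1 = n) := by omega
      have h2 : n - 1 + 1 = n := by omega
      simp [h1, h2, hpow]
      linear_combination (β * Complex.I) * hεε
    · have h1 : ¬ ((a : ℕ) = n - 1 + 1) := by omega
      have h2 : ¬ ((a : ℕ) + 1 = n) := by omega
      have h3 : a ≠ ⟨n - 1, Nat.sub_lt hpos one_pos⟩ := fun h => ha (congrArg Fin.val h)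
      simp [h1, h2, h3]
  · by_cases ha : (a : ℕ) = 0
    · have : a = ⟨0, hpos⟩ := Fin.ext ha
      subst this
      have h2 : n - 1 + 1 = n := by omega
      simp [h2]
      linear_combination ((β : ℂ) * ε) * Complex.I_sq
    · have h2 : ¬ ((a : ℕ) + (n - 1) + 1 = n) := by omega
      have h3 : a ≠ ⟨0, hpos⟩ := fun h => ha (congrArg Fin.val h)
      simp [h2, h3]

theorem mem_complexSpectrum_oddBlock {n : ℕ} (hn : Odd n) (β : ℝ) {ε : ℝ} (hε : ε = 1 ∨ ε = -1) :
    (β * Complex.I : ℂ) ∈ complexSpectrum (oddBlock n β ε) := by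
  refine mem_complexSpectrum_iff.2 ⟨_, fun h => ?_, oddBlock_eigenvector hn β hε⟩
  have := congrFun h (Sum.inl ⟨n - 1, Nat.sub_lt hn.pos one_pos⟩)
  simp at this

/-- For `n = 1` the eigenvector is `(1, -i ε)`, so the form recovers `ε`. -/
theorem exists_krein_oddBlock {n : ℕ} (hn : n = 1) {β ε : ℝ} (hε : ε = 1 ∨ ε = -1) {B : Mat n}
    (hB : B = oddBlock n β ε) : ∃ u ≠ 0, complexify B *ᵥ u = (β * Complex.I) • u ∧
      krein n u = -(2 * ε * Complex.I) := by
  subst hn hB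
  refine ⟨_, fun h => ?_, oddBlock_eigenvector odd_one β hε, ?_⟩
  · have := congrFun h (Sum.inl 0)
    simp at this
  · rw [krein, complexify, stdJ, Matrix.fromBlocks_map, Matrix.fromBlocks_mulVec]
    simp [dotProduct, Matrix.one_apply]
    ring

/-! ### Reading off an arbitrary normal form -/

namespace NormalForm

variable {N : ℕ} {β : ℝ} {M : Mat N} (F : NormalForm β M)

/-- The blocks of a normal form in symplectic frames. -/
theorem exists_frames :
    ∃ E : ∀ j, Matrix (Fin N ⊕ Fin N) (Fin (F.n j) ⊕ Fin (F.n j)) ℝ,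
      (∀ j, IsSymplecticFrame (E j)) ∧ (∀ j k, j ≠ k → (E j)ᵀ * stdJ N * E k = 0) ∧
      (∀ j, M * E j = E j * F.block j) ∧
      ∑ j, E j * stdJ (F.n j) * (E j)ᵀ = stdJ N := by
  classical
  obtain ⟨S, hS, hsim⟩ := F.similar
  let e := Equiv.sumCongr F.coord F.coord
  let G := S.submatrix id e
  have hMG : M * G = G * assemble F.n F.block := by
    have h1 : M * S = S * Matrix.reindex e e (assemble F.n F.block) := by
      rw [hsim, ← mul_assoc, ← mul_assoc,
        Matrix.mul_nonsing_inv _ (SymplecticGroup.symplectic_det hS), one_mul]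
    have h2 : M * G = (M * S).submatrix id e := rfl
    rw [h2, h1, ← Matrix.submatrix_mul_equiv _ _ _ e]
    congr 1
    simp [Matrix.reindex_apply]
  have hGG : Gᵀ * stdJ N * G = Matrix.fromBlocks 0 1 (-1) 0 := by
    have h1 : Gᵀ * stdJ N * G = (Sᵀ * stdJ N * S).submatrix e e := rfl
    rw [h1, mem_symplecticGroup_iff.1 hS, stdJ_submatrix]
  let K : Matrix ((Σ j, Fin (F.n j)) ⊕ (Σ j, Fin (F.n j)))
      ((Σ j, Fin (F.n j)) ⊕ (Σ j, Fin (F.n j))) ℝ := Matrix.fromBlocks 0 1 (-1) 0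
  -- The transpose of a symplectic matrix is symplectic too. Sorted by blocks, this resolves `J`,
  -- and hence the identity, into contributions of the frames.
  have hGG' : G * K * Gᵀ = stdJ N := by
    have hK : K = (stdJ N).submatrix e e := (stdJ_submatrix F.coord).symm
    rw [hK]
    change S.submatrix id e * (stdJ N).submatrix e e * Sᵀ.submatrix e id = _
    rw [Matrix.submatrix_mul_equiv, Matrix.submatrix_mul_equiv, Matrix.submatrix_id_id]
    exact mem_symplecticGroup_iff'.1 hS
  have hentry : ∀ j k (c : Fin (F.n j) ⊕ Fin (F.n j)) (d : Fin (F.n k) ⊕ Fin (F.n k)),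
      ((blockColumns G j)ᵀ * stdJ N * blockColumns G k) c d =
        (Gᵀ * stdJ N * G) (blockIncl F.n j c)
          (blockIncl F.n k d) := fun j k c d => rfl
  refine ⟨blockColumns G, ?_, ?_, ?_, ?_⟩
  · intro j
    ext c d
    rw [hentry, hGG]
    rcases c with c | c <;> rcases d with d | d <;> simp [stdJ, Matrix.one_apply]
  · intro j k h
    ext c d
    rw [hentry, hGG]
    rcases c with c | c <;> rcases d with d | d <;> simp [h]
  · intro j
    rw [← blockColumns_mul, hMG, blockColumns_mul_assemble]
  · rw [← hGG']
    have hassemble : K = assemble F.n fun j => stdJ (F.n j) := by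
      simp only [K, assemble, stdJ, Matrix.toBlocks_fromBlocks₁₁, Matrix.toBlocks_fromBlocks₁₂,
        Matrix.toBlocks_fromBlocks₂₁, Matrix.toBlocks_fromBlocks₂₂]
      congr 1
      · exact (Matrix.blockDiagonal'_zero).symm
      · exact (Matrix.blockDiagonal'_one).symm
      · rw [← Matrix.blockDiagonal'_one, ← Matrix.blockDiagonal'_neg]
        rfl
      · exact (Matrix.blockDiagonal'_zero).symm
    rw [hassemble]
    have hmul : ∀ A : Matrix (Fin N ⊕ Fin N) ((Σ j, Fin (F.n j)) ⊕ (Σ j, Fin (F.n j))) ℝ,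
        A * Gᵀ = ∑ j, blockColumns A j * (blockColumns G j)ᵀ := by
      intro A
      ext i k
      simp only [Matrix.mul_apply, Matrix.sum_apply, Fintype.sum_sum_type, Fintype.sum_sigma,
        Finset.sum_add_distrib]
      rfl
    rw [hmul]
    exact Finset.sum_congr rfl fun j _ => by rw [blockColumns_mul_assemble]

end NormalForm

theorem eigenvector_of_frame {N n : ℕ} {β : ℝ} {M : Mat N}
    {E : Matrix (Fin N ⊕ Fin N) (Fin n ⊕ Fin n) ℝ} {B : Mat n} (hB : M * E = E * B)
    {u : Fin n ⊕ Fin n → ℂ} (hu : complexify B *ᵥ u = (β * Complex.I) • u) :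
    complexify M *ᵥ (E.map (algebraMap ℝ ℂ) *ᵥ u) =
      (β * Complex.I) • (E.map (algebraMap ℝ ℂ) *ᵥ u) := by
  rw [complexify_mul_frame hB, hu, mulVec_smul]

namespace NormalForm

variable {N : ℕ} {β : ℝ} {M : Mat N} (F : NormalForm β M)

/-- Every eigenvalue `β i` of `M` is an eigenvalue of a block. -/
theorem exists_block_mem_complexSpectrum (h : (β * Complex.I : ℂ) ∈ complexSpectrum M) :
    ∃ j, (β * Complex.I : ℂ) ∈ complexSpectrum (F.block j) := by
  obtain ⟨E, hE, horth, hB, hsum⟩ := F.exists_frames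
  obtain ⟨z, hz0, hz⟩ := mem_complexSpectrum_iff.1 h
  let L := fun j => -(stdJ (F.n j) * (E j)ᵀ * stdJ N)
  have hone : ∑ j, E j * L j = 1 := by
    have h1 : ∀ j, E j * L j = -(E j * stdJ (F.n j) * (E j)ᵀ * stdJ N) := fun j => by
      simp [L, Matrix.mul_assoc]
    simp only [h1, Finset.sum_neg_distrib, ← Finset.sum_mul]
    rw [hsum, stdJ_mul_stdJ, neg_neg]
  -- The projections `L j` intertwine `M` with the blocks. As the `E j * L j` sum to the identity,
  -- some `L j` does not kill `z` and maps it to an eigenvector.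
  have hLM : ∀ j, L j * M = F.block j * L j := by
    intro j
    have h1 : L j * M = ∑ k, L j * (E k * F.block k) * L k := by
      calc L j * M = L j * M * ∑ k, E k * L k := by rw [hone, Matrix.mul_one]
        _ = _ := by
          rw [Matrix.mul_sum]
          exact Finset.sum_congr rfl fun k _ => by rw [← hB]; simp only [Matrix.mul_assoc]
    rw [h1, Finset.sum_eq_single j]
    · rw [← Matrix.mul_assoc, (hE j).leftInverse_mul, Matrix.one_mul]
    · intro k _ hk
      have : L j * E k = 0 := by
        simp only [L]
        rw [Matrix.neg_mul, Matrix.mul_assoc, Matrix.mul_assoc, ← Matrix.mul_assoc (E j)ᵀ,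
          horth j k hk.symm, Matrix.mul_zero, neg_zero]
      rw [← Matrix.mul_assoc, this, Matrix.zero_mul, Matrix.zero_mul]
    · simp
  obtain ⟨j, hj⟩ : ∃ j, (L j).map (algebraMap ℝ ℂ) *ᵥ z ≠ 0 := by
    by_contra! h0
    have h1 : (∑ j, E j * L j).map (algebraMap ℝ ℂ) *ᵥ z = 0 := by
      have h2 : (∑ j, E j * L j).map (algebraMap ℝ ℂ) =
          ∑ j, (E j).map (algebraMap ℝ ℂ) * (L j).map (algebraMap ℝ ℂ) := by
        rw [← RingHom.mapMatrix_apply, map_sum]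
        exact Finset.sum_congr rfl fun j _ => by rw [RingHom.mapMatrix_apply, Matrix.map_mul]
      rw [h2, Matrix.sum_mulVec]
      exact Finset.sum_eq_zero fun j _ => by rw [← mulVec_mulVec, h0, mulVec_zero]
    rw [hone, Matrix.map_one _ (map_zero _) (map_one _), one_mulVec] at h1
    exact hz0 h1
  refine ⟨j, mem_complexSpectrum_iff.2 ⟨_, hj, ?_⟩⟩
  rw [mulVec_mulVec, complexify, ← Matrix.map_mul, ← hLM, Matrix.map_mul, ← mulVec_mulVec,
    ← mulVec_smul, ← hz]
  rfl

/-- The eigenvalue `β i` belongs to at most one block. -/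
theorem block_unique (hs : SemisimplePair β M) {j k : Fin F.s}
    (hj : (β * Complex.I : ℂ) ∈ complexSpectrum (F.block j))
    (hk : (β * Complex.I : ℂ) ∈ complexSpectrum (F.block k)) : k = j := by
  obtain ⟨E, hE, horth, hB, -⟩ := F.exists_frames
  by_contra hne
  obtain ⟨u, hu0, hu⟩ := mem_complexSpectrum_iff.1 hj
  obtain ⟨v, hv0, hv⟩ := mem_complexSpectrum_iff.1 hk
  obtain ⟨c, hc⟩ := hs.proportional _ _ (eigenvector_of_frame (hB j) hu)
    (eigenvector_of_frame (hB k) hv)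
    (fun h0 => hu0 ((hE j).map_mulVec_injective (by simpa using h0)))
  -- Pairing with the frame `E j` kills `E k v` by orthogonality, but turns `c • E j u` into `c • J
  -- u`; hence `c = 0` or `u = 0`.
  have h1 : ((E j)ᵀ * stdJ N).map (algebraMap ℝ ℂ) *ᵥ ((E k).map (algebraMap ℝ ℂ) *ᵥ v) = 0 := by
    rw [mulVec_mulVec, ← Matrix.map_mul, horth j k (Ne.symm hne),
      Matrix.map_zero _ (map_zero _), zero_mulVec]
  rw [hc, mulVec_smul, mulVec_mulVec, ← Matrix.map_mul, hE j] at h1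
  have h2 : c • u = 0 := by
    have h3 : (stdJ (F.n j)).map (algebraMap ℝ ℂ) * (stdJ (F.n j)).map (algebraMap ℝ ℂ) = -1 := by
      rw [← Matrix.map_mul, stdJ_mul_stdJ, ← RingHom.mapMatrix_apply, map_neg, map_one]
    have := congrArg ((stdJ (F.n j)).map (algebraMap ℝ ℂ) *ᵥ ·) h1
    simpa only [mulVec_smul, mulVec_mulVec, h3, neg_mulVec, one_mulVec, smul_neg, mulVec_zero,
      neg_eq_zero] using this
  rcases smul_eq_zero.1 h2 with h | h
  · rw [h, zero_smul] at hc
    exact hv0 ((hE k).map_mulVec_injective (by simpa using hc))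
  · exact hu0 h

theorem exists_simple_block (hβ : 0 < β) (hs : SemisimplePair β M)
    (h : (β * Complex.I : ℂ) ∈ complexSpectrum M) :
    ∃ j, F.n j = 1 ∧ ∀ k, (β * Complex.I : ℂ) ∈ complexSpectrum (F.block k) ↔ k = j := by
  obtain ⟨j, hj⟩ := F.exists_block_mem_complexSpectrum h
  obtain ⟨E, hE, -, hB, -⟩ := F.exists_frames
  refine ⟨j, eq_one_of_indecomposable hβ (F.hamiltonian j) (hs.of_frame (hE j) (hB j))
    (F.indecomposable j) hj, fun k => ⟨fun hk => F.block_unique hs hj hk, ?_⟩⟩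
  rintro rfl
  exact hj

theorem oddBlock_injective {n : ℕ} (hn : 0 < n) {β ε ε' : ℝ} (hβ : 0 < β)
    (h : oddBlock n β ε = oddBlock n β ε') : ε = ε' := by
  have := congrFun (congrFun h (Sum.inr ⟨0, hn⟩)) (Sum.inl ⟨n - 1, Nat.sub_lt hn one_pos⟩)
  have h2 : n - 1 + 1 = n := by omega
  simpa [oddBlock, h2, hβ.ne'] using this

/-- The numbers of blocks of a normal form, with the sign read off from an eigenvector. -/
theorem exists_sign (hβ : 0 < β) (hs : SemisimplePair β M)
    (h : (β * Complex.I : ℂ) ∈ complexSpectrum M) :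
    ∃ ε : ℝ, (ε = 1 ∨ ε = -1) ∧
      (∀ ε', ε' = 1 ∨ ε' = -1 → F.numO ε' = (if ε' = ε then 1 else 0) ∧ F.numE ε' = 0) ∧
      ∃ z ≠ 0, complexify M *ᵥ z = (β * Complex.I) • z ∧ krein N z = -(2 * ε * Complex.I) := by
  classical
  obtain ⟨j, hj1, hj⟩ := F.exists_simple_block hβ hs h
  obtain ⟨ε, hε, hstd⟩ := F.standard j ((hj j).2 rfl)
  have hodd : Odd (F.n j) := hj1 ▸ odd_one
  have hblock : F.block j = oddBlock (F.n j) β ε := by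
    rcases hstd with h | h
    · exact h.2
    · exact absurd h.1 (Nat.not_even_iff_odd.2 hodd)
  obtain ⟨E, hE, -, hB, -⟩ := F.exists_frames
  obtain ⟨u, hu0, hu, hku⟩ := exists_krein_oddBlock hj1 hε hblock
  -- Every standard odd block has the eigenvalue `β i`, so each block that is counted is the simple
  -- one.
  have huniq : ∀ k ε', (ε' = 1 ∨ ε' = -1) → Odd (F.n k) → F.block k = oddBlock (F.n k) β ε' →
      k = j := fun k ε' hε' hk hbk =>
    (hj k).1 (hbk ▸ mem_complexSpectrum_oddBlock hk β hε')
  refine ⟨ε, hε, fun ε' hε' => ⟨?_, ?_⟩, (E j).map (algebraMap ℝ ℂ) *ᵥ u, ?_,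
    eigenvector_of_frame (hB j) hu, by rw [krein_frame (hE j), hku]⟩
  · split_ifs with heq
    · subst heq
      rw [numO, Finset.card_eq_one]
      refine ⟨j, ?_⟩
      ext k
      simp only [Finset.mem_filter, Finset.mem_univ, true_and, Finset.mem_singleton]
      refine ⟨fun hk => huniq k _ hε hk.1 hk.2.2, ?_⟩
      rintro rfl
      -- `(1 + 1) / 2 = 1` is odd, so the simple block counts for `numO` and never for `numE`.
      exact ⟨hodd, by rw [hj1]; decide, hblock⟩
    · rw [numO, Finset.card_eq_zero, Finset.filter_eq_empty_iff]
      rintro k - ⟨hk, -, hbk⟩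
      obtain rfl := huniq k _ hε' hk hbk
      exact heq (oddBlock_injective hk.pos hβ (hbk.symm.trans hblock))
  · rw [numE, Finset.card_eq_zero, Finset.filter_eq_empty_iff]
    rintro k - ⟨hk, heven, hbk⟩
    obtain rfl := huniq k _ hε' hk hbk
    rw [hj1] at heven
    exact absurd heven (by decide)
  · exact fun h0 => hu0 ((hE j).map_mulVec_injective (by simpa using h0))

end NormalForm

/-! ### Independence of the normal form and conclusion -/

/-- The sign is the same for all normal forms. -/
theorem exists_common_sign {N : ℕ} {β : ℝ} {M : Mat N} (hβ : 0 < β) (hs : SemisimplePair β M)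
    (h : (β * Complex.I : ℂ) ∈ complexSpectrum M) (hF : Nonempty (NormalForm β M)) :
    ∃ ε : ℝ, (ε = 1 ∨ ε = -1) ∧ ∀ F : NormalForm β M, ∀ ε', ε' = 1 ∨ ε' = -1 →
      F.numO ε' = (if ε' = ε then 1 else 0) ∧ F.numE ε' = 0 := by
  classical
  obtain ⟨F₀⟩ := hF
  obtain ⟨ε, hε, -, z, hz0, hz, hkz⟩ := F₀.exists_sign hβ hs h
  refine ⟨ε, hε, fun F => ?_⟩
  obtain ⟨ε₁, hε₁, hnum, w, hw0, hw, hkw⟩ := F.exists_sign hβ hs h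
  obtain ⟨c, rfl⟩ := hs.proportional z w hz hw hz0
  rw [krein_smul, hkz] at hkw
  -- The eigenvectors from the two normal forms differ by the factor `c`; as `|c|² ≥ 0`, the signs
  -- cannot be opposite.
  have h1 : Complex.normSq c * ε = ε₁ := by
    have := congrArg Complex.im hkw
    simp at this
    linarith
  have h2 := Complex.normSq_nonneg c
  have : ε₁ = ε := by
    rcases hε with rfl | rfl <;> rcases hε₁ with rfl | rfl <;> first | rfl | (exfalso; linarith)
  rwa [this] at hnum

end LyapunovCenter

end

open LyapunovCenter in
theorem proposition3p3 (N : ℕ) (Ω : Set (Phase N)) (hΩ : IsOpen Ω) (h0 : (0 : Phase N) ∈ Ω)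
    (H : Phase N → ℝ) (hH : ContDiffOn ℝ 2 H Ω) (hcrit : gradient H 0 = 0)
    (β₀ : ℝ) (hA0 : Nonresonant β₀ (linearization H)) :
    -- the pair of eigenvalues is simple, also in the sense of algebraic multiplicities
    IsSimpleEigenvaluePair β₀ (linearization H) ∧
    (complexify (linearization H)).charpoly.rootMultiplicity (β₀ * Complex.I) = 1 ∧
    (complexify (linearization H)).charpoly.rootMultiplicity (-(β₀ * Complex.I)) = 1 ∧
    -- the Brouwer index of the isolated critical point
    (brouwerIndex 0 (gradient H) = 1 ∨ brouwerIndex 0 (gradient H) = -1) ∧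
    -- the numbers of blocks
    ((oNum β₀ (linearization H) 1 = 1 ∧ oNum β₀ (linearization H) (-1) = 0) ∨
      (oNum β₀ (linearization H) 1 = 0 ∧ oNum β₀ (linearization H) (-1) = 1)) ∧
    eNum β₀ (linearization H) 1 = 0 ∧ eNum β₀ (linearization H) (-1) = 0 ∧
    -- they are the same in every normal form
    (∀ F : NormalForm β₀ (linearization H), ∀ ε : ℝ, ε = 1 ∨ ε = -1 →
      F.numO ε = oNum β₀ (linearization H) ε ∧ F.numE ε = eNum β₀ (linearization H) ε) ∧
    SumCondition β₀ (linearization H) ∧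
    CenterTheoremAssumptions Ω H β₀ := by
  classical
  have hH0 : ContDiffAt ℝ 2 H 0 := hH.contDiffAt (hΩ.mem_nhds h0)
  have hβ := hA0.1
  have hs := hA0.semisimplePair
  obtain ⟨hm1, hm2⟩ := hA0.rootMultiplicity
  have hspec := mem_complexSpectrum_of_rootMultiplicity hm1
  have hspec' := mem_complexSpectrum_of_rootMultiplicity hm2
  have hF := nonempty_normalForm hβ (isHamiltonian_linearization hH0) hs
  have hdet : (fderiv ℝ (gradient H) 0).det ≠ 0 := by
    rw [det_fderiv_gradient]
    exact det_linearization H hA0.det_ne_zero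
  have hindex := hasBrouwerIndex_of_det_ne_zero (contDiffAt_gradient hH0) hcrit hdet
  have hbi : brouwerIndex 0 (gradient H) = 1 ∨ brouwerIndex 0 (gradient H) = -1 := by
    rw [hindex.brouwerIndex_eq]
    rcases lt_or_gt_of_ne hdet with h | h
    · exact Or.inr (by simp [sign_neg h])
    · exact Or.inl (by simp [sign_pos h])
  obtain ⟨ε, hε, hnum⟩ := exists_common_sign hβ hs hspec hF
  have hO : ∀ ε', ε' = 1 ∨ ε' = -1 →
      oNum β₀ (linearization H) ε' = (if ε' = ε then 1 else 0) ∧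
      eNum β₀ (linearization H) ε' = 0 := by
    intro ε' hε'
    -- A normal form exists, so the default value `0` does not occur, and the chosen normal form is
    -- immaterial because `hnum` holds for all of them.
    rw [oNum, eNum, dif_pos hF, dif_pos hF]
    exact hnum _ ε' hε'
  obtain ⟨ho1, he1⟩ := hO 1 (Or.inl rfl)
  obtain ⟨ho2, he2⟩ := hO (-1) (Or.inr rfl)
  have ho : (oNum β₀ (linearization H) 1 = 1 ∧ oNum β₀ (linearization H) (-1) = 0) ∨
      (oNum β₀ (linearization H) 1 = 0 ∧ oNum β₀ (linearization H) (-1) = 1) := by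
    rw [ho1, ho2]
    rcases hε with rfl | rfl
    · left; norm_num
    · right; norm_num
  have hsum : SumCondition β₀ (linearization H) := by
    rw [SumCondition, he1, he2]
    rcases ho with ⟨h1, h2⟩ | ⟨h1, h2⟩ <;> rw [h1, h2] <;> norm_num
  refine ⟨⟨hspec, hspec', hF, fun F => F.exists_simple_block hβ hs hspec⟩, hm1, hm2, hbi, ho, he1,
    he2, fun F ε' hε' => ?_, hsum, hΩ, hH, h0, hindex.2.1, ?_, hβ, hspec, hspec', hsum⟩
  · rw [(hO ε' hε').1, (hO ε' hε').2]
    exact hnum F ε' hε'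
  · rcases hbi with h | h <;> rw [h] <;> norm_num
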